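/- Let $\gamma>1$ and $0<u_1\le 1/\gamma^4<1\le u_2<\infty$, and consider the minimum-time transfer from $(1,0)$ to $(\gamma,0)$ for the control system $$\dot x_1=x_2,\qquad \dot x_2=-u\,x_1+\frac1{x_1^3}\qquad(x_1>0),$$ where the admissible controls are the Lebesgue measurable functions $u$ on $[0,T]$ with values in $[u_1,u_2]$ almost everywhere. Let $$H(\lambda_0,\lambda,x,u)=\lambda_0+\lambda_1x_2+\lambda_2\Big(\frac1{x_1^3}-u\,x_1\Big).$$ An extremal is a controlled trajectory $(x,u)$ on $[0,T]$ ($x$ absolutely continuous and solving the system for almost every $t$) with $x(0)=(1,0)$, $x(T)=(\gamma,0)$, for which there are a constant $\lambda_0\le0$ and an absolutely continuous $\lambda=(\lambda_1,\lambda_2)$, not identically zero, such that $\dot\lambda=-\partial H/\partial x$, $u(t)$ maximizes $v\mapsto H(\lambda_0,\lambda(t),x(t),v)$ over $[u_1,u_2]$, and $H(\lambda_0,\lambda(t),x(t),u(t))=0$, for almost every $t\in[0,T]$. Call a segment with $u\equiv u_1$ an $X$-segment and one with $u\equiv u_2$ a $Y$-segment (equality almost everywhere). **Theorem.** Every extremal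 is bang-bang, and has either the form $XYX\cdots XY$ with $2n+1$ switchings, for some $n\ge0$, or the form $YXY\cdots XY$ with $2n$ switchings, for some $n\ge1$. Put $c_1=u_1+1$, $c_2=u_2+1$, $c=u_2\gamma^2+1/\gamma^2$ and, for $s>0$, $$T_X=\frac1{2\sqrt{u_1}}\cos^{-1}\Big(\frac{s-u_1}{s+u_1}\Big),\qquad T_Y=\frac1{2\sqrt{u_2}}\Big(2\pi-\cos^{-1}\Big(\frac{s-u_2}{s+u_2}\Big)\Big),$$ $$T_F=\frac1{2\sqrt{u_2}}\cos^{-1}\left(\frac{-sc+u_2\sqrt{c^2-4(s+u_2)}}{(s+u_2)\sqrt{c^2-4u_2}}\right),$$ $$T^{\pm}_{I,1}=\frac1{2\sqrt{u_1}}\cos^{-1}\left(\frac{sc_1\mp u_1\sqrt{c_1^2-4(s+u_1)}}{(s+u_1)\sqrt{c_1^2-4u_1}}\right),\qquad T^{\pm}_{I,2}=\frac1{2\sqrt{u_2}}\cos^{-1}\left(\frac{-sc_2\pm u_2\sqrt{c_2^2-4(s+u_2)}}{(s+u_2)\sqrt{c_2^2-4u_2}}\right),$$ with $\cos^{-1}$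 taking values in $[0,\pi]$. (a) If an extremal has the form $XYX\cdots XY$ with $2n+1$ switchings, $n\ge0$, then for one of the two signs its duration is $$T=T^\pm_{2n+1}=T^\pm_{I,1}+n(T_X+T_Y)+T_F,$$ where $s$ is a solution of $$\frac{c+\sqrt{c^2-4(s+u_2)}}{c_1\pm\sqrt{c_1^2-4(s+u_1)}}=\Big(\frac{s+u_2}{s+u_1}\Big)^{n+1}$$ (same sign) in the interval $0<s\le\min\{(1-u_1)^2/4,\ (u_2\gamma^2-1/\gamma^2)^2/4\}$. (b) If an extremal has the form $YXY\cdots XY$ with $2n$ switchings, $n\ge1$, then for one of the two signs its duration is $$T=T^\pm_{2n}=T^\pm_{I,2}+nT_X+(n-1)T_Y+T_F,$$ where $s$ is a solution of $$\frac{c+\sqrt{c^2-4(s+u_2)}}{c_2\mp\sqrt{c_2^2-4(s+u_2)}}=\Big(\frac{s+u_2}{s+u_1}\Big)^{n}$$ (upper and lower signs corresponding) in the interval $0<s\le(u_2-1)^2/4$. -/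

import Mathlib

open MeasureTheory Set

namespace Ermakov

/-! ### The control system and its extremals -/

/-- The second component of the controlled vector field `f + u g`, where
`f = (x₂, 1 / x₁ ^ 3)` and `g = (0, -x₁)`; the first component is `x₂`. -/
noncomputable def accel (x₁ u : ℝ) : ℝ := -u * x₁ + 1 / x₁ ^ 3

/-- `(x₁, x₂, u)` is a controlled trajectory on `[0, T]`, with control set `[u₁, u₂]`, of
`x₁' = x₂`, `x₂' = -u x₁ + 1 / x₁ ^ 3` in the half plane `x₁ > 0`: the control is Lebesgue
measurable with values in `[u₁, u₂]` almost everywhere, and the state is an absolutely continuous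
(Carathéodory) solution. Only the values on `[0, T]` matter. -/
structure IsControlledTrajectory (u₁ u₂ T : ℝ) (x₁ x₂ u : ℝ → ℝ) : Prop where
  time_nonneg : 0 ≤ T
  aemeasurable_control : AEMeasurable u (volume.restrict (Icc 0 T))
  control_mem : ∀ᵐ t, t ∈ Icc 0 T → u t ∈ Icc u₁ u₂
  pos : ∀ t ∈ Icc 0 T, 0 < x₁ t
  absCont₁ : AbsolutelyContinuousOnInterval x₁ 0 T
  absCont₂ : AbsolutelyContinuousOnInterval x₂ 0 T
  hasDerivAt₁ : ∀ᵐ t, t ∈ Icc 0 T → HasDerivAt x₁ (x₂ t) t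
  hasDerivAt₂ : ∀ᵐ t, t ∈ Icc 0 T → HasDerivAt x₂ (accel (x₁ t) (u t)) t

/-- The control Hamiltonian `H(p₀, p, x, u) = p₀ + ⟨p, f(x) + u g(x)⟩`. -/
noncomputable def hamiltonian (p₀ p₁ p₂ x₁ x₂ u : ℝ) : ℝ :=
  p₀ + (p₁ * x₂ + p₂ * accel x₁ u)

/-- The multipliers `p₀`, `p = (p₁, p₂)` satisfy the conditions of Pontryagin's maximum principle
for minimum time along `(x₁, x₂, u)` on `[0, T]`: `p₀ ≤ 0`, `p` is absolutely continuous and not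
identically zero, `p' = -∂H/∂x`, the control maximizes the Hamiltonian over `[u₁, u₂]`, and the
Hamiltonian vanishes along the trajectory. The last two conditions are imposed for almost every
time, as the control is only determined up to null sets. -/
structure IsPontryaginMultiplier (u₁ u₂ T : ℝ) (x₁ x₂ u : ℝ → ℝ) (p₀ : ℝ) (p₁ p₂ : ℝ → ℝ) :
    Prop where
  nonpos : p₀ ≤ 0
  absCont₁ : AbsolutelyContinuousOnInterval p₁ 0 T
  absCont₂ : AbsolutelyContinuousOnInterval p₂ 0 T
  nontrivial : ∃ t ∈ Icc 0 T, (p₁ t, p₂ t) ≠ (0, 0)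
  adjoint₁ : ∀ᵐ t, t ∈ Icc 0 T →
    HasDerivAt p₁ (-deriv (fun y => hamiltonian p₀ (p₁ t) (p₂ t) y (x₂ t) (u t)) (x₁ t)) t
  adjoint₂ : ∀ᵐ t, t ∈ Icc 0 T →
    HasDerivAt p₂ (-deriv (fun y => hamiltonian p₀ (p₁ t) (p₂ t) (x₁ t) y (u t)) (x₂ t)) t
  maximum : ∀ᵐ t, t ∈ Icc 0 T →
    IsMaxOn (fun v => hamiltonian p₀ (p₁ t) (p₂ t) (x₁ t) (x₂ t) v) (Icc u₁ u₂) (u t)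
  hamiltonian_eq_zero : ∀ᵐ t, t ∈ Icc 0 T →
    hamiltonian p₀ (p₁ t) (p₂ t) (x₁ t) (x₂ t) (u t) = 0

/-- `(x₁, x₂, u)` is an extremal on `[0, T]` for the minimum-time transfer from `(1, 0)` to
`(γ, 0)` with control set `[u₁, u₂]` (normal or abnormal). -/
structure IsExtremal (u₁ u₂ γ T : ℝ) (x₁ x₂ u : ℝ → ℝ) : Prop where
  trajectory : IsControlledTrajectory u₁ u₂ T x₁ x₂ u
  initial₁ : x₁ 0 = 1
  initial₂ : x₂ 0 = 0
  final₁ : x₁ T = γ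
  final₂ : x₂ T = 0
  exists_multiplier : ∃ (p₀ : ℝ) (p₁ p₂ : ℝ → ℝ), IsPontryaginMultiplier u₁ u₂ T x₁ x₂ u p₀ p₁ p₂

/-- On `[0, T]` the control `u` is bang-bang with exactly `N` switchings, alternating between the
values `a` and `b` and starting with `a`: there are times `0 = τ 0 < τ 1 < ⋯ < τ (N + 1) = T` with
`u = a` a.e. on the segments `(τ k, τ (k + 1))` with `k ≤ N` even, and `u = b` a.e. on those with
`k ≤ N` odd. -/
def IsBangBang (T : ℝ) (u : ℝ → ℝ) (a b : ℝ) (N : ℕ) : Prop :=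
  ∃ τ : ℕ → ℝ, τ 0 = 0 ∧ τ (N + 1) = T ∧ (∀ k ≤ N, τ k < τ (k + 1)) ∧
    ∀ k ≤ N, ∀ᵐ t, t ∈ Ioo (τ k) (τ (k + 1)) → u t = if Even k then a else b

/-- The form `XYX…XY` with `2 n + 1` switchings (`X`: `u = u₁`, `Y`: `u = u₂`). -/
def IsFormXY (u₁ u₂ T : ℝ) (u : ℝ → ℝ) (n : ℕ) : Prop := IsBangBang T u u₁ u₂ (2 * n + 1)

/-- The form `YXY…XY` with `2 n` switchings (`X`: `u = u₁`, `Y`: `u = u₂`). -/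
def IsFormYXY (u₁ u₂ T : ℝ) (u : ℝ → ℝ) (n : ℕ) : Prop := IsBangBang T u u₂ u₁ (2 * n)

/-! ### The explicit times

Here `σ` stands for the sign in `±`, and takes the values `1` and `-1`. -/

/-- The constant `c = u₂ γ² + 1 / γ²`. -/
noncomputable def cFin (u₂ γ : ℝ) : ℝ := u₂ * γ ^ 2 + 1 / γ ^ 2

/-- The time `T_{I,1}^±`, where `c₁ = u₁ + 1`. -/
noncomputable def timeInitX (u₁ σ s : ℝ) : ℝ :=
  1 / (2 * √u₁) * Real.arccos
    ((s * (u₁ + 1) - σ * u₁ * √((u₁ + 1) ^ 2 - 4 * (s + u₁))) /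
      ((s + u₁) * √((u₁ + 1) ^ 2 - 4 * u₁)))

/-- The time `T_{I,2}^±`, where `c₂ = u₂ + 1`. -/
noncomputable def timeInitY (u₂ σ s : ℝ) : ℝ :=
  1 / (2 * √u₂) * Real.arccos
    ((-s * (u₂ + 1) + σ * u₂ * √((u₂ + 1) ^ 2 - 4 * (s + u₂))) /
      ((s + u₂) * √((u₂ + 1) ^ 2 - 4 * u₂)))

/-- The time `T_F`. -/
noncomputable def timeFin (u₂ γ s : ℝ) : ℝ :=
  1 / (2 * √u₂) * Real.arccos
    ((-s * cFin u₂ γ + u₂ * √(cFin u₂ γ ^ 2 - 4 * (s + u₂))) /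
      ((s + u₂) * √(cFin u₂ γ ^ 2 - 4 * u₂)))

/-- The time `T_X`. -/
noncomputable def timeX (u₁ s : ℝ) : ℝ :=
  1 / (2 * √u₁) * Real.arccos ((s - u₁) / (s + u₁))

/-- The time `T_Y`. -/
noncomputable def timeY (u₂ s : ℝ) : ℝ :=
  1 / (2 * √u₂) * (2 * Real.pi - Real.arccos ((s - u₂) / (s + u₂)))

/-- The total time `T_{2n+1}^±` as a function of the parameter `s`. -/
noncomputable def timeOdd (u₁ u₂ γ σ : ℝ) (n : ℕ) (s : ℝ) : ℝ :=
  timeInitX u₁ σ s + n * (timeX u₁ s + timeY u₂ s) + timeFin u₂ γ s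

/-- The total time `T_{2n}^±` as a function of the parameter `s`. -/
noncomputable def timeEven (u₁ u₂ γ σ : ℝ) (n : ℕ) (s : ℝ) : ℝ :=
  timeInitY u₂ σ s + n * timeX u₁ s + ((n : ℝ) - 1) * timeY u₂ s + timeFin u₂ γ s

/-- `s` is a solution of the transcendental equation for the form `XYX…XY` with `2 n + 1`
switchings, in the prescribed interval. -/
def SolvesOdd (u₁ u₂ γ σ : ℝ) (n : ℕ) (s : ℝ) : Prop :=
  (0 < s ∧ s ≤ min ((1 - u₁) ^ 2 / 4) ((u₂ * γ ^ 2 - 1 / γ ^ 2) ^ 2 / 4)) ∧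
    (cFin u₂ γ + √(cFin u₂ γ ^ 2 - 4 * (s + u₂))) /
      ((u₁ + 1) + σ * √((u₁ + 1) ^ 2 - 4 * (s + u₁))) = ((s + u₂) / (s + u₁)) ^ (n + 1)

/-- `s` is a solution of the transcendental equation for the form `YXY…XY` with `2 n`
switchings, in the prescribed interval. -/
def SolvesEven (u₁ u₂ γ σ : ℝ) (n : ℕ) (s : ℝ) : Prop :=
  (0 < s ∧ s ≤ (u₂ - 1) ^ 2 / 4) ∧
    (cFin u₂ γ + √(cFin u₂ γ ^ 2 - 4 * (s + u₂))) /
      ((u₂ + 1) - σ * √((u₂ + 1) ^ 2 - 4 * (s + u₂))) = ((s + u₂) / (s + u₁)) ^ n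

end Ermakov

namespace Ermakov

open Filter Topology

section

/-! ### One-variable calculus on compact intervals -/

/-! The multiplier decouples from the state. With `W = p₂ x₁` and `V = p₂ x₂ - p₁ x₁`, maximality
depends only on the sign of `W`, and the vanishing Hamiltonian eliminates the state from `V'`,
leaving `W' = V`, `V' = 2 p₀ - 4 u W`. Since `u W` is a continuous function of `W`, this planar
system is autonomous, with first integral `D`. A double zero of `W` would force the multiplier to
vanish identically, so the zeros of `W` are simple, hence finitely many, and the control is
bang-bang (`exists_switchingSystem`, `exists_isBangBang`).

At a switching `V² = D` and `V x₂ = p₀ x₁`, so every switching state satisfies `x₂² = s x₁²` with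
the same `s = p₀² / D`; this is the parameter of the theorem. For constant control `κ`, both `W` and
`x₁²` are harmonic with frequency `2 √κ`. A full arc between switchings therefore has a duration
depending on `s` and `κ` only, and the values `y`, `z` of `x₁²` at its ends satisfy `(s + κ) y z =
1` (`state_of_full_arc`). Conservation of energy on the first and last arcs adds one quadratic
equation each.

What remains is algebra of this recursion. The bounds on `u₁` and `u₂` exclude extremals without
switchings, the abnormal case `s = 0` and a final `X`-segment (`ne_zero`, `invariant_ne_zero`,
`last_control`). A pair `YX` multiplies `x₁²` by `(s + u₂) / (s + u₁)`; comparing the roots of the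
two quadratics through this factor gives the transcendental equation, and adding the arc durations
gives `T`. -/

theorem eq_left_of_hasDerivWithinAt_zero {f : ℝ → ℝ} {a b : ℝ}
    (hf : ∀ t ∈ Icc a b, HasDerivWithinAt f 0 (Icc a b) t) {t : ℝ} (ht : t ∈ Icc a b) :
    f t = f a := by
  refine constant_of_has_deriv_right_zero (fun t ht => (hf t ht).continuousWithinAt)
    (fun t ht => ?_) t ht
  exact (hf t (Ico_subset_Icc_self ht)).mono_of_mem_nhdsWithin (Icc_mem_nhdsGE_of_mem ht)

/-- An absolutely continuous function whose derivative agrees almost everywhere with a continuous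
function is continuously differentiable. -/
theorem hasDerivWithinAt_of_absolutelyContinuous {f g : ℝ → ℝ} {a b : ℝ} (hab : a ≤ b)
    (hf : AbsolutelyContinuousOnInterval f a b) (hg : ContinuousOn g (Icc a b))
    (hfg : ∀ᵐ t, t ∈ Ioo a b → HasDerivAt f (g t) t) {t : ℝ} (ht : t ∈ Icc a b) :
    HasDerivWithinAt f (g t) (Icc a b) t := by
  set G : ℝ → ℝ := IccExtend hab (fun t => g t) with hG
  have hGc : Continuous G := continuousOn_iff_continuous_domRestrict.mp hg |>.Icc_extend'
  have hGg : ∀ t ∈ Icc a b, G t = g t := fun t ht => IccExtend_of_mem hab _ ht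
  have hI : ∀ t, HasDerivAt (fun t => ∫ y in a..t, G y) (G t) t := fun t =>
    intervalIntegral.integral_hasDerivAt_right (hGc.intervalIntegrable _ _)
      (hGc.stronglyMeasurableAtFilter _ _) hGc.continuousAt
  have hIac : AbsolutelyContinuousOnInterval (fun t => ∫ y in a..t, G y) a b :=
    (hGc.intervalIntegrable _ _).absolutelyContinuousOnInterval_intervalIntegral (by simp)
  obtain ⟨C, hC⟩ := (hf.sub hIac).const_of_ae_hasDerivAt_zero (by
    filter_upwards [hfg, Measure.ae_ne volume a, Measure.ae_ne volume b] with t ht hta htb htm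
    rw [uIcc_of_le hab] at htm
    have h1 := ht ⟨lt_of_le_of_ne htm.1 hta.symm, lt_of_le_of_ne htm.2 htb⟩
    have h2 := h1.sub (hI t)
    rw [hGg t htm, sub_self] at h2
    exact h2)
  rw [uIcc_of_le hab] at hC
  have h3 : ∀ t ∈ Icc a b, f t = C + ∫ y in a..t, G y := by
    intro t ht
    have := hC t ht
    simp only [Pi.sub_apply] at this
    linarith
  have h4 : HasDerivWithinAt (fun t => C + ∫ y in a..t, G y) (G t) (Icc a b) t :=
    ((hI t).const_add C).hasDerivWithinAt
  rw [hGg t ht] at h4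
  exact h4.congr h3 (h3 t ht)

/-- Solution formula for the oscillator `f'' = ω² (m - f)`. -/
theorem oscillator_formula {f g : ℝ → ℝ} {a b ω m : ℝ} (hω : ω ≠ 0)
    (hf : ∀ t ∈ Icc a b, HasDerivWithinAt f (g t) (Icc a b) t)
    (hg : ∀ t ∈ Icc a b, HasDerivWithinAt g (ω ^ 2 * (m - f t)) (Icc a b) t)
    {t : ℝ} (ht : t ∈ Icc a b) :
    f t = m + (f a - m) * Real.cos (ω * (t - a)) + g a / ω * Real.sin (ω * (t - a)) ∧
      g t = -(f a - m) * ω * Real.sin (ω * (t - a)) + g a * Real.cos (ω * (t - a)) := by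
  have hlin : ∀ t, HasDerivWithinAt (fun t => ω * (t - a)) ω (Icc a b) t := fun t => by
    simpa using (((hasDerivAt_id t).sub_const a).const_mul ω).hasDerivWithinAt
  -- The phase vector `(f - m, g / ω)`, rotated back by the angle `ω (t - a)`, is constant; its
  -- coordinates are treated in turn.
  have hP : ∀ t ∈ Icc a b, HasDerivWithinAt (fun t => (f t - m) * Real.cos (ω * (t - a))
      - g t / ω * Real.sin (ω * (t - a))) 0 (Icc a b) t := by
    intro t ht
    refine ((((hf t ht).sub_const m).mul (hlin t).cos).sub
      (((hg t ht).div_const ω).mul (hlin t).sin)).congr_deriv ?_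
    field_simp
    ring
  have hQ : ∀ t ∈ Icc a b, HasDerivWithinAt (fun t => (f t - m) * Real.sin (ω * (t - a))
      + g t / ω * Real.cos (ω * (t - a))) 0 (Icc a b) t := by
    intro t ht
    refine ((((hf t ht).sub_const m).mul (hlin t).sin).add
      (((hg t ht).div_const ω).mul (hlin t).cos)).congr_deriv ?_
    field_simp
    ring
  have h1 := eq_left_of_hasDerivWithinAt_zero hP ht
  have h2 := eq_left_of_hasDerivWithinAt_zero hQ ht
  simp only [sub_self, mul_zero, Real.cos_zero, Real.sin_zero, mul_one, sub_zero, zero_add] at h1 h2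
  have h3 := Real.sin_sq_add_cos_sq (ω * (t - a))
  have h4 : g t / ω * ω = g t := div_mul_cancel₀ _ hω
  have h5 : g a / ω * ω = g a := div_mul_cancel₀ _ hω
  constructor
  · linear_combination (Real.cos (ω * (t - a))) * h1 + Real.sin (ω * (t - a)) * h2
      - (f t - m) * h3
  · linear_combination (-ω * Real.sin (ω * (t - a))) * h1 + ω * Real.cos (ω * (t - a)) * h2
      - g t * h3 + Real.cos (ω * (t - a)) * h5
      - (Real.sin (ω * (t - a)) ^ 2 + Real.cos (ω * (t - a)) ^ 2) * h4

theorem deriv_nonneg_of_pos_right {f : ℝ → ℝ} {f' a b : ℝ} (hab : a < b)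
    (hf : HasDerivWithinAt f f' (Icc a b) a) (h0 : f a = 0) (hpos : ∀ t ∈ Ioo a b, 0 ≤ f t) :
    0 ≤ f' := by
  have h1 := (hf.mono Ioo_subset_Icc_self)
  rw [hasDerivWithinAt_iff_tendsto_slope' (by simp)] at h1
  have : NeBot (𝓝[Ioo a b] a) := by
    rw [nhdsWithin_Ioo_eq_nhdsGT hab]; infer_instance
  refine ge_of_tendsto h1 (eventually_nhdsWithin_of_forall fun t ht => ?_)
  rw [slope_def_field, h0, sub_zero]
  exact div_nonneg (hpos t ht) (by linarith [ht.1])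

theorem deriv_nonpos_of_pos_left {f : ℝ → ℝ} {f' a b : ℝ} (hab : a < b)
    (hf : HasDerivWithinAt f f' (Icc a b) b) (h0 : f b = 0) (hpos : ∀ t ∈ Ioo a b, 0 ≤ f t) :
    f' ≤ 0 := by
  have h1 := (hf.mono Ioo_subset_Icc_self)
  rw [hasDerivWithinAt_iff_tendsto_slope' (by simp)] at h1
  have : NeBot (𝓝[Ioo a b] b) := by
    rw [nhdsWithin_Ioo_eq_nhdsLT hab]; infer_instance
  refine le_of_tendsto h1 (eventually_nhdsWithin_of_forall fun t ht => ?_)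
  rw [slope_def_field, h0, sub_zero]
  exact div_nonpos_of_nonneg_of_nonpos (hpos t ht) (by linarith [ht.2])

theorem eventually_pos_of_hasDerivWithinAt_pos {f : ℝ → ℝ} {f' a b : ℝ} (hab : a < b)
    (hf : HasDerivWithinAt f f' (Icc a b) a) (h0 : f a = 0) (hf' : 0 < f') :
    ∀ᶠ t in 𝓝[>] a, 0 < f t := by
  have h1 := (hf.mono Ioo_subset_Icc_self)
  rw [hasDerivWithinAt_iff_tendsto_slope' (by simp), nhdsWithin_Ioo_eq_nhdsGT hab] at h1
  filter_upwards [h1.eventually_const_lt hf', self_mem_nhdsWithin] with t ht hat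
  rw [slope_def_field, h0, sub_zero] at ht
  exact (div_pos_iff_of_pos_right (sub_pos.mpr hat)).mp ht

theorem hasDerivAt_mul_abs_self (y : ℝ) : HasDerivAt (fun y : ℝ => y * |y|) (2 * |y|) y := by
  rcases lt_trichotomy y 0 with hy | rfl | hy
  · refine ((hasDerivAt_id y).mul (hasDerivAt_abs_neg hy)).congr_deriv ?_
    rw [abs_of_neg hy]; simp; ring
  · rw [hasDerivAt_iff_tendsto_slope]
    have : Tendsto (fun y : ℝ => |y|) (𝓝[≠] 0) (𝓝 |(0:ℝ)|) :=
      continuous_abs.continuousAt.tendsto.mono_left nhdsWithin_le_nhds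
    simp only [abs_zero, mul_zero] at this ⊢
    refine this.congr' ?_
    filter_upwards [self_mem_nhdsWithin] with t ht
    rw [slope_def_field]
    have : t ≠ 0 := ht
    field_simp
    simp
  · refine ((hasDerivAt_id y).mul (hasDerivAt_abs_pos hy)).congr_deriv ?_
    rw [abs_of_pos hy]; simp; ring

/-! ### Sign changes of a function with simple zeros -/

/-- By compactness infinitely many zeros would accumulate at a zero, but a zero with nonzero
derivative is isolated. -/
theorem finite_zeros_of_deriv_ne_zero {f f' : ℝ → ℝ} {a b : ℝ}
    (hf : ∀ t ∈ Icc a b, HasDerivWithinAt f (f' t) (Icc a b) t)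
    (hf' : ∀ t ∈ Icc a b, f t = 0 → f' t ≠ 0) : {t ∈ Icc a b | f t = 0}.Finite := by
  by_contra hinf
  obtain ⟨c, hc, hacc⟩ := (show {t ∈ Icc a b | f t = 0}.Infinite from hinf)
    |>.exists_accPt_of_subset_isCompact isCompact_Icc (fun t ht => ht.1)
  have hcont : ContinuousOn f (Icc a b) := fun t ht => (hf t ht).continuousWithinAt
  have hclosed : IsClosed {t ∈ Icc a b | f t = 0} := by
    have := hcont.preimage_isClosed_of_isClosed isClosed_Icc (isClosed_singleton (x := (0:ℝ)))
    exact this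
  have hc0 : f c = 0 := (hclosed.closure_eq ▸ hacc.clusterPt.mem_closure).2
  have h1 := (hf c hc).eventually_ne (c := 0) (hf' c hc hc0)
  rw [eventually_nhdsWithin_iff] at h1
  refine (accPt_iff_frequently_nhdsNE.mp hacc) ?_
  rw [eventually_nhdsWithin_iff]
  filter_upwards [h1] with t ht htc hz
  exact ht ⟨hz.1, htc⟩ hz.2

theorem pos_of_ne_zero_of_eventually_pos {f : ℝ → ℝ} {a b : ℝ} (hf : ContinuousOn f (Ioo a b))
    (hne : ∀ t ∈ Ioo a b, f t ≠ 0) (h0 : ∀ᶠ t in 𝓝[>] a, 0 < f t) {t : ℝ} (ht : t ∈ Ioo a b) :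
    0 < f t := by
  by_contra hneg
  obtain ⟨r, hr, har⟩ := (h0.and (Ioo_mem_nhdsGT ht.1)).exists
  have hsub : Icc r t ⊆ Ioo a b := fun y hy => ⟨har.1.trans_le hy.1, hy.2.trans_lt ht.2⟩
  obtain ⟨y, hy, hy0⟩ := intermediate_value_Icc' har.2.le (hf.mono hsub) ⟨not_lt.mp hneg, hr.le⟩
  exact hne y (hsub hy) hy0

/-- A function with finitely many zeros in `(a, b)`, all of them simple, has alternating signs on
the intervals between them. -/
theorem exists_alternating_partition (n : ℕ) : ∀ {f f' : ℝ → ℝ} {a b : ℝ}, a < b →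
    (∀ t ∈ Icc a b, HasDerivWithinAt f (f' t) (Icc a b) t) →
    (∀ t ∈ Ioo a b, f t = 0 → f' t ≠ 0) →
    {t ∈ Ioo a b | f t = 0}.Finite → {t ∈ Ioo a b | f t = 0}.ncard = n →
    (∀ᶠ t in 𝓝[>] a, 0 < f t) →
    ∃ τ : ℕ → ℝ, τ 0 = a ∧ τ (n + 1) = b ∧ (∀ k ≤ n, τ k < τ (k + 1)) ∧
      ∀ k ≤ n, ∀ t ∈ Ioo (τ k) (τ (k + 1)), 0 < (-1) ^ k * f t := by
  induction n with
  | zero =>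
    intro f f' a b hab hf hf' hfin hcard h0
    have hempty := (ncard_eq_zero hfin).mp hcard
    have hcont : ContinuousOn f (Ioo a b) := fun t ht =>
      ((hf t (Ioo_subset_Icc_self ht)).mono Ioo_subset_Icc_self).continuousWithinAt
    refine ⟨fun k => if k = 0 then a else b, by simp, by simp, ?_, ?_⟩
    · intro k hk
      obtain rfl := Nat.le_zero.mp hk
      simpa using hab
    · intro k hk t ht
      obtain rfl := Nat.le_zero.mp hk
      simp only [if_true, zero_add, one_ne_zero, if_false] at ht
      simpa using pos_of_ne_zero_of_eventually_pos hcont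
        (fun y hy hy0 => (hempty ▸ (⟨hy, hy0⟩ : y ∈ {t ∈ Ioo a b | f t = 0}) : y ∈ (∅ : Set ℝ)))
        h0 ht
  | succ n ih =>
    intro f f' a b hab hf hf' hfin hcard h0
    have hnon : {t ∈ Ioo a b | f t = 0}.Nonempty := by
      rw [← ncard_pos hfin]; omega
    -- The smallest zero `c` is split off. There `f` passes from positive to negative, so the
    -- induction hypothesis applies to `-f` on `[c, b]`.
    obtain ⟨c, ⟨hcab, hc0⟩, hmin⟩ := exists_min_image _ id hfin hnon
    have hcont : ContinuousOn f (Ioo a c) := fun t ht =>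
      ((hf t ⟨ht.1.le, (ht.2.trans hcab.2).le⟩).mono
        (fun y hy => ⟨hy.1.le, (hy.2.trans hcab.2).le⟩)).continuousWithinAt
    have hpos : ∀ t ∈ Ioo a c, 0 < f t := fun t ht =>
      pos_of_ne_zero_of_eventually_pos hcont (fun y hy hy0 =>
        absurd (hmin y ⟨⟨hy.1, hy.2.trans hcab.2⟩, hy0⟩) (not_le.mpr hy.2)) h0 ht
    have hder : ∀ t ∈ Icc c b, HasDerivWithinAt f (f' t) (Icc c b) t := fun t ht =>
      (hf t ⟨hcab.1.le.trans ht.1, ht.2⟩).mono (Icc_subset_Icc_left hcab.1.le)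
    have hneg : f' c < 0 := lt_of_le_of_ne (deriv_nonpos_of_pos_left hcab.1
      ((hf c (Ioo_subset_Icc_self hcab)).mono (Icc_subset_Icc_right hcab.2.le)) hc0
      (fun t ht => (hpos t ht).le)) (hf' c hcab hc0)
    have hZ : {t ∈ Ioo c b | (-f) t = 0} = {t ∈ Ioo a b | f t = 0} \ {c} := by
      ext t
      simp only [mem_ofPred_eq, Pi.neg_apply, neg_eq_zero, Set.mem_sdiff, mem_singleton_iff]
      constructor
      · rintro ⟨h1, h2⟩
        exact ⟨⟨⟨hcab.1.trans h1.1, h1.2⟩, h2⟩, h1.1.ne'⟩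
      · rintro ⟨⟨h1, h2⟩, h3⟩
        exact ⟨⟨lt_of_le_of_ne (hmin t ⟨h1, h2⟩) (Ne.symm h3), h1.2⟩, h2⟩
    have hcard' : {t ∈ Ioo c b | (-f) t = 0}.ncard = n := by
      rw [hZ, ncard_sdiff_singleton_of_mem
        (show c ∈ {t ∈ Ioo a b | f t = 0} from ⟨hcab, hc0⟩), hcard]
      rfl
    obtain ⟨τ, hτ0, hτn, hτlt, hτ⟩ := ih (f := -f) (f' := -f') hcab.2
      (fun t ht => (hder t ht).neg)
      (fun t ht h => by
        simpa using hf' t ⟨hcab.1.trans ht.1, ht.2⟩ (by simpa using h))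
      (hZ ▸ hfin.sdiff) hcard'
      (eventually_pos_of_hasDerivWithinAt_pos hcab.2 (hder c ⟨le_rfl, hcab.2.le⟩).neg
        (by simp [hc0]) (by linarith))
    refine ⟨fun k => if k = 0 then a else τ (k - 1), by simp, by simpa using hτn, ?_, ?_⟩
    · rintro (_ | k) hk
      · simpa [hτ0] using hcab.1
      · simpa using hτlt k (by omega)
    · rintro (_ | k) hk t ht
      · simp only [if_true, zero_add, one_ne_zero, if_false, Nat.sub_self, hτ0] at ht
        simpa using hpos t ht
      · simp only [Nat.add_eq_zero_iff, one_ne_zero, and_false, if_false,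
          Nat.add_sub_cancel] at ht
        have := hτ k (by omega) t ht
        rw [Pi.neg_apply] at this
        rw [pow_succ]
        linarith

end

/-! ### The switching function as the solution of an autonomous equation -/

/-- The value of `u y` when `u` is chosen in `[u₁, u₂]` so as to minimize it. -/
noncomputable def feedback (u₁ u₂ y : ℝ) : ℝ := (u₁ + u₂) / 2 * y + (u₁ - u₂) / 2 * |y|

theorem feedback_of_nonneg {u₁ u₂ y : ℝ} (hy : 0 ≤ y) : feedback u₁ u₂ y = u₁ * y := by
  rw [feedback, abs_of_nonneg hy]; ring

theorem feedback_of_nonpos {u₁ u₂ y : ℝ} (hy : y ≤ 0) : feedback u₁ u₂ y = u₂ * y := by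
  rw [feedback, abs_of_nonpos hy]; ring

theorem continuous_feedback (u₁ u₂ : ℝ) : Continuous (feedback u₁ u₂) := by
  unfold feedback; fun_prop

/-- The function is `u₁ y²` for `y ≥ 0` and `u₂ y²` for `y ≤ 0`, hence C¹ across `0`. This lets the
energy of `(W, V)` be differentiated through switchings. -/
theorem hasDerivAt_feedback_mul (u₁ u₂ y : ℝ) :
    HasDerivAt (fun y => feedback u₁ u₂ y * y) (2 * feedback u₁ u₂ y) y := by
  have h := (((hasDerivAt_id y).mul (hasDerivAt_id y)).const_mul ((u₁ + u₂) / 2)).add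
    ((hasDerivAt_mul_abs_self y).const_mul ((u₁ - u₂) / 2))
  refine (h.congr_deriv ?_).congr_of_eventuallyEq (.of_forall fun z => ?_)
  · simp [feedback]; ring
  · simp [feedback]; ring

/-- A trajectory together with its switching function `W = p₂ x₁` and the derivative
`V = p₂ x₂ - p₁ x₁` of the latter. -/
structure IsSwitchingSystem (u₁ u₂ T p₀ D : ℝ) (x₁ x₂ u W V : ℝ → ℝ) : Prop where
  time_pos : 0 < T
  trajectory : IsControlledTrajectory u₁ u₂ T x₁ x₂ u
  nonpos : p₀ ≤ 0
  hasDeriv_state : ∀ t ∈ Icc 0 T, HasDerivWithinAt x₁ (x₂ t) (Icc 0 T) t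
  hasDeriv_switching : ∀ t ∈ Icc 0 T, HasDerivWithinAt W (V t) (Icc 0 T) t
  hasDeriv_velocity : ∀ t ∈ Icc 0 T,
    HasDerivWithinAt V (2 * p₀ - 4 * feedback u₁ u₂ (W t)) (Icc 0 T) t
  control : ∀ᵐ t, t ∈ Icc 0 T → (0 < W t → u t = u₁) ∧ (W t < 0 → u t = u₂)
  energy : ∀ t ∈ Icc 0 T, V t ^ 2 + 4 * (feedback u₁ u₂ (W t) * W t) - 4 * p₀ * W t = D
  velocity_ne_zero : ∀ t ∈ Icc 0 T, W t = 0 → V t ≠ 0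
  hamiltonian : ∀ t ∈ Icc 0 T, p₀ - V t * (x₂ t / x₁ t) +
    W t * ((x₂ t / x₁ t) ^ 2 + 1 / x₁ t ^ 4) - feedback u₁ u₂ (W t) = 0

theorem deriv_hamiltonian_fst (p₀ p₁ p₂ x₂ u : ℝ) {y : ℝ} (hy : y ≠ 0) :
    deriv (fun y => hamiltonian p₀ p₁ p₂ y x₂ u) y = -p₂ * (u + 3 / y ^ 4) := by
  unfold hamiltonian accel
  have h1 : HasDerivAt (fun y : ℝ => 1 / y ^ 3) (-3 / y ^ 4) y := by
    have := ((hasDerivAt_const y (1 : ℝ)).div (hasDerivAt_pow 3 y) (pow_ne_zero 3 hy))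
    refine this.congr_deriv ?_
    field_simp
    norm_num [mul_comm]
  have h2 := ((((hasDerivAt_id y).const_mul (-u)).add h1).const_mul p₂).const_add (p₁ * x₂)
    |>.const_add p₀
  refine Eq.trans (HasDerivAt.deriv ?_) (b := p₂ * (-u * 1 + -3 / y ^ 4)) ?_
  · exact h2
  · ring

theorem deriv_hamiltonian_snd (p₀ p₁ p₂ x₁ u y : ℝ) :
    deriv (fun y => hamiltonian p₀ p₁ p₂ x₁ y u) y = p₁ := by
  unfold hamiltonian
  have h2 := (((hasDerivAt_id y).const_mul p₁).add_const (p₂ * accel x₁ u)).const_add p₀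
  exact (HasDerivAt.deriv h2).trans (mul_one p₁)

/-- The Hamiltonian depends on `v` only through `-v p₂ x₁`. The last conclusion holds also where `p₂
x₁ = 0` and the control is undetermined. -/
theorem control_mul_eq_feedback {u₁ u₂ p₀ p₁ p₂ x₁ x₂ u : ℝ} (hu : u ∈ Icc u₁ u₂)
    (hmax : IsMaxOn (fun v => hamiltonian p₀ p₁ p₂ x₁ x₂ v) (Icc u₁ u₂) u) :
    (0 < p₂ * x₁ → u = u₁) ∧ (p₂ * x₁ < 0 → u = u₂) ∧
      u * (p₂ * x₁) = feedback u₁ u₂ (p₂ * x₁) := by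
  have h : ∀ v ∈ Icc u₁ u₂, u * (p₂ * x₁) ≤ v * (p₂ * x₁) := by
    intro v hv
    have := hmax hv
    simp only [hamiltonian, accel, mem_ofPred_eq] at this
    linarith
  have hle : u₁ ≤ u₂ := hu.1.trans hu.2
  have h1 : 0 < p₂ * x₁ → u = u₁ := fun hp =>
    le_antisymm (le_of_mul_le_mul_right (h u₁ ⟨le_rfl, hle⟩) hp) hu.1
  have h2 : p₂ * x₁ < 0 → u = u₂ := fun hp =>
    le_antisymm hu.2 ((mul_le_mul_right_of_neg hp).mp (h u₂ ⟨hle, le_rfl⟩))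
  refine ⟨h1, h2, ?_⟩
  rcases lt_trichotomy (p₂ * x₁) 0 with hp | hp | hp
  · rw [feedback_of_nonpos hp.le, h2 hp]
  · rw [hp]; simp [feedback]
  · rw [feedback_of_nonneg hp.le, h1 hp]

theorem IsExtremal.exists_switchingSystem {u₁ u₂ γ T : ℝ} {x₁ x₂ u : ℝ → ℝ} (hu₁ : 0 < u₁)
    (hu : u₁ ≤ u₂) (hγ : γ ≠ 1) (h : IsExtremal u₁ u₂ γ T x₁ x₂ u) :
    ∃ (p₀ D : ℝ) (W V : ℝ → ℝ), IsSwitchingSystem u₁ u₂ T p₀ D x₁ x₂ u W V := by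
  obtain ⟨p₀, p₁, p₂, hp⟩ := h.exists_multiplier
  have tr := h.trajectory
  have hT : 0 < T := by
    refine lt_of_le_of_ne tr.time_nonneg fun hT => hγ ?_
    rw [← h.final₁, ← hT, h.initial₁]
  have hIcc : uIcc 0 T = Icc 0 T := uIcc_of_le hT.le
  have cx₁ := hIcc ▸ tr.absCont₁.continuousOn
  have cx₂ := hIcc ▸ tr.absCont₂.continuousOn
  have cp₁ := hIcc ▸ hp.absCont₁.continuousOn
  have cp₂ := hIcc ▸ hp.absCont₂.continuousOn
  have hx0 : ∀ t ∈ Icc 0 T, x₁ t ≠ 0 := fun t ht => (tr.pos t ht).ne'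
  set W : ℝ → ℝ := p₂ * x₁ with hW
  set V : ℝ → ℝ := p₂ * x₂ - p₁ * x₁ with hV
  have cW : ContinuousOn W (Icc 0 T) := cp₂.mul cx₁
  have cV : ContinuousOn V (Icc 0 T) := (cp₂.mul cx₂).sub (cp₁.mul cx₁)
  have cg : ContinuousOn (fun t => feedback u₁ u₂ (W t)) (Icc 0 T) :=
    (continuous_feedback u₁ u₂).comp_continuousOn cW
  have hae : ∀ᵐ t, t ∈ Icc 0 T → (0 < W t → u t = u₁) ∧ (W t < 0 → u t = u₂) ∧
      u t * W t = feedback u₁ u₂ (W t) := by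
    filter_upwards [tr.control_mem, hp.maximum] with t h1 h2 ht
    exact control_mul_eq_feedback (h1 ht) (h2 ht)
  have dW : ∀ t ∈ Icc 0 T, HasDerivWithinAt W (V t) (Icc 0 T) t := fun t ht => by
    refine hasDerivWithinAt_of_absolutelyContinuous hT.le (hp.absCont₂.mul tr.absCont₁) cV ?_ ht
    filter_upwards [hp.adjoint₂, tr.hasDerivAt₁] with t h1 h2 ht
    have ht := Ioo_subset_Icc_self ht
    refine ((h1 ht).mul (h2 ht)).congr_deriv ?_
    rw [deriv_hamiltonian_snd]
    simp [hV]; ring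
  have dV : ∀ t ∈ Icc 0 T,
      HasDerivWithinAt V (2 * p₀ - 4 * feedback u₁ u₂ (W t)) (Icc 0 T) t := fun t ht => by
    refine hasDerivWithinAt_of_absolutelyContinuous
      (g := fun t => 2 * p₀ - 4 * feedback u₁ u₂ (W t)) hT.le ((hp.absCont₂.mul tr.absCont₂).sub (hp.absCont₁.mul tr.absCont₁)) (by fun_prop) ?_ ht
    filter_upwards [hp.adjoint₁, hp.adjoint₂, tr.hasDerivAt₁, tr.hasDerivAt₂,
      hp.hamiltonian_eq_zero, hae] with t h1 h2 h3 h4 h5 h6 ht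
    have ht := Ioo_subset_Icc_self ht
    refine (((h2 ht).mul (h4 ht)).sub ((h1 ht).mul (h3 ht))).congr_deriv ?_
    rw [deriv_hamiltonian_snd, deriv_hamiltonian_fst _ _ _ _ _ (hx0 t ht), ← (h6 ht).2.2]
    have h5 := h5 ht
    have hx := hx0 t ht
    simp only [hamiltonian, accel, hW, Pi.mul_apply] at h5 ⊢
    have e : 3 / x₁ t ^ 4 * x₁ t = 3 * (1 / x₁ t ^ 3) := by field_simp
    -- The product rule gives `V' = -2 (p₁ x₂ + p₂ / x₁³ + u W)`, and `H = 0` replaces `p₁ x₂ + p₂ /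
    -- x₁³` by `u W - p₀`.
    linear_combination (-2) * h5 - p₂ t * e
  -- Written with the feedback in place of `u W`, the Hamiltonian is continuous, so it vanishes at
  -- every time and not just almost everywhere.
  have ham : ∀ t ∈ Icc 0 T, p₀ - V t * (x₂ t / x₁ t) +
      W t * ((x₂ t / x₁ t) ^ 2 + 1 / x₁ t ^ 4) - feedback u₁ u₂ (W t) = 0 := by
    refine Measure.eqOn_Icc_of_ae_eq volume hT.ne ?_ ?_ continuousOn_const (g := fun _ => (0:ℝ))
    · rw [EventuallyEq, ae_restrict_iff' measurableSet_Icc]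
      filter_upwards [hp.hamiltonian_eq_zero, hae] with t h1 h2 ht
      have h1 := h1 ht
      have hx := hx0 t ht
      rw [← (h2 ht).2.2, ← h1]
      simp only [hamiltonian, accel, hW, hV, Pi.mul_apply, Pi.sub_apply]
      field_simp
      ring
    · have : ∀ t ∈ Icc 0 T, x₁ t ^ 4 ≠ 0 := fun t ht => pow_ne_zero 4 (hx0 t ht)
      have c1 : ContinuousOn (fun t => x₂ t / x₁ t) (Icc 0 T) := cx₂.div cx₁ hx0
      have c2 : ContinuousOn (fun t => 1 / x₁ t ^ 4) (Icc 0 T) :=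
        continuousOn_const.div (cx₁.pow 4) this
      fun_prop
  have energy : ∀ t ∈ Icc 0 T, V t ^ 2 + 4 * (feedback u₁ u₂ (W t) * W t) - 4 * p₀ * W t =
      V 0 ^ 2 + 4 * (feedback u₁ u₂ (W 0) * W 0) - 4 * p₀ * W 0 := fun t ht => by
    refine eq_left_of_hasDerivWithinAt_zero (f := fun t => V t ^ 2 +
      4 * (feedback u₁ u₂ (W t) * W t) - 4 * p₀ * W t) (fun t ht => ?_) ht
    refine ((((dV t ht).pow 2).add
      (((hasDerivAt_feedback_mul u₁ u₂ (W t)).comp_hasDerivWithinAt t (dW t ht)).const_mul 4)).sub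
        ((dW t ht).const_mul (4 * p₀))).congr_deriv ?_
    push_cast
    ring
  refine ⟨p₀, _, W, V, hT, tr, hp.nonpos, fun t ht => ?_, dW, dV, ?_, energy, ?_, ham⟩
  · refine hasDerivWithinAt_of_absolutelyContinuous hT.le tr.absCont₁ cx₂ ?_ ht
    filter_upwards [tr.hasDerivAt₁] with t h1 ht using h1 (Ioo_subset_Icc_self ht)
  · filter_upwards [hae] with t h1 ht using ⟨(h1 ht).1, (h1 ht).2.1⟩
  · intro t ht hWt hVt
    -- A double zero makes `p₀` and the energy vanish. The energy is then at least `V² + 4 u₁ W²`,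
    -- so `W`, `V` and with them `p` vanish everywhere.
    have hp0 : p₀ = 0 := by simpa [hWt, hVt, feedback] using ham t ht
    have h0 : ∀ r ∈ Icc 0 T, W r = 0 ∧ V r = 0 := by
      intro r hr
      have e := (energy r hr).trans (energy t ht).symm
      rw [hWt, hVt, hp0] at e
      have hW2 : u₁ * W r ^ 2 ≤ feedback u₁ u₂ (W r) * W r := by
        rcases le_total 0 (W r) with hr | hr
        · rw [feedback_of_nonneg hr]; exact (by ring : _ = _).le
        · rw [feedback_of_nonpos hr]; nlinarith [sq_nonneg (W r)]
      have h1 := mul_nonneg hu₁.le (sq_nonneg (W r))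
      have h2 := sq_nonneg (V r)
      constructor
      · have : u₁ * W r ^ 2 = 0 := by linarith
        simpa [hu₁.ne'] using this
      · have : V r ^ 2 = 0 := by linarith
        simpa using this
    obtain ⟨r, hr, hne⟩ := hp.nontrivial
    obtain ⟨h1, h2⟩ := h0 r hr
    have hp2 : p₂ r = 0 := by simpa [hW, hx0 r hr] using h1
    have hp1 : p₁ r = 0 := by simpa [hV, hp2, hx0 r hr] using h2
    exact hne (by rw [hp1, hp2])

section

/-! ### Arcs with constant control -/

/-- On `(a, b)` the control has the constant value `κ`, and the switching function has the sign
`ε` belonging to it. -/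
structure IsArc (u₁ u₂ T : ℝ) (u W : ℝ → ℝ) (κ ε a b : ℝ) : Prop where
  nonneg : 0 ≤ a
  lt : a < b
  le : b ≤ T
  sign : (ε = 1 ∧ κ = u₁) ∨ (ε = -1 ∧ κ = u₂)
  control : ∀ᵐ t, t ∈ Ioo a b → u t = κ
  pos : ∀ t ∈ Ioo a b, 0 < ε * W t

theorem arccos_cos_of_sin_nonneg {θ : ℝ} (h0 : 0 ≤ θ) (h1 : θ < 2 * Real.pi)
    (hs : 0 ≤ Real.sin θ) : Real.arccos (Real.cos θ) = θ := by
  refine Real.arccos_cos h0 (not_lt.mp fun h => ?_)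
  have := Real.sin_pos_of_pos_of_lt_pi (x := θ - Real.pi) (by linarith) (by linarith)
  rw [Real.sin_sub_pi] at this
  linarith

theorem arccos_cos_of_sin_nonpos {θ : ℝ} (h0 : 0 < θ) (h1 : θ ≤ 2 * Real.pi)
    (hs : Real.sin θ ≤ 0) : Real.arccos (Real.cos θ) = 2 * Real.pi - θ := by
  rw [← Real.cos_two_pi_sub]
  refine arccos_cos_of_sin_nonneg (by linarith) (by linarith) ?_
  rw [Real.sin_two_pi_sub]
  linarith

variable {u₁ u₂ T p₀ D : ℝ} {x₁ x₂ u W V : ℝ → ℝ} {κ ε a b : ℝ}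

namespace IsArc

theorem subset (A : IsArc u₁ u₂ T u W κ ε a b) : Icc a b ⊆ Icc 0 T :=
  Icc_subset_Icc A.nonneg A.le

theorem left_mem (A : IsArc u₁ u₂ T u W κ ε a b) : a ∈ Icc a b := ⟨le_rfl, A.lt.le⟩

theorem right_mem (A : IsArc u₁ u₂ T u W κ ε a b) : b ∈ Icc a b := ⟨A.lt.le, le_rfl⟩

theorem sign_sq (A : IsArc u₁ u₂ T u W κ ε a b) : ε ^ 2 = 1 := by
  rcases A.sign with ⟨rfl, -⟩ | ⟨rfl, -⟩ <;> norm_num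

theorem ne_zero (A : IsArc u₁ u₂ T u W κ ε a b) {t : ℝ} (ht : t ∈ Ioo a b) :
    W t ≠ 0 := fun h => by simpa [h] using A.pos t ht

end IsArc

/-! ### Switching relations, oscillations and durations of single arcs -/

namespace IsSwitchingSystem

theorem sq_velocity (S : IsSwitchingSystem u₁ u₂ T p₀ D x₁ x₂ u W V) {t : ℝ} (ht : t ∈ Icc 0 T)
    (h0 : W t = 0) : V t ^ 2 = D := by
  simpa [h0] using S.energy t ht

theorem energy_pos (S : IsSwitchingSystem u₁ u₂ T p₀ D x₁ x₂ u W V) {t : ℝ} (ht : t ∈ Icc 0 T)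
    (h0 : W t = 0) : 0 < D := by
  rw [← S.sq_velocity ht h0]
  have := S.velocity_ne_zero t ht h0
  positivity

theorem velocity_mul (S : IsSwitchingSystem u₁ u₂ T p₀ D x₁ x₂ u W V) {t : ℝ} (ht : t ∈ Icc 0 T)
    (h0 : W t = 0) : V t * x₂ t = p₀ * x₁ t := by
  have hx := (S.trajectory.pos t ht).ne'
  have := S.hamiltonian t ht
  rw [h0] at this
  simp only [feedback, abs_zero, mul_zero, zero_mul, add_zero, sub_zero] at this
  field_simp at this
  linarith

/-- Eliminating `V` between `V² = D` and `V x₂ = p₀ x₁` puts all switching states on one pair of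
lines through the origin. -/
theorem sq_state_snd (S : IsSwitchingSystem u₁ u₂ T p₀ D x₁ x₂ u W V) {t : ℝ} (ht : t ∈ Icc 0 T)
    (h0 : W t = 0) : x₂ t ^ 2 = p₀ ^ 2 / D * x₁ t ^ 2 := by
  have h1 := S.velocity_mul ht h0
  have h2 := S.sq_velocity ht h0
  have h3 := S.energy_pos ht h0
  field_simp
  linear_combination (-x₂ t ^ 2) * h2 + (V t * x₂ t + p₀ * x₁ t) * h1

theorem continuousOn_switching (S : IsSwitchingSystem u₁ u₂ T p₀ D x₁ x₂ u W V) :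
    ContinuousOn W (Icc 0 T) := fun t ht => (S.hasDeriv_switching t ht).continuousWithinAt

theorem sign_switching (S : IsSwitchingSystem u₁ u₂ T p₀ D x₁ x₂ u W V)
    (A : IsArc u₁ u₂ T u W κ ε a b) {t : ℝ} (ht : t ∈ Icc a b) : 0 ≤ ε * W t := by
  have hc : ContinuousOn (fun t => ε * W t) (closure (Ioo a b)) := by
    rw [closure_Ioo A.lt.ne]
    exact continuousOn_const.mul (S.continuousOn_switching.mono A.subset)
  rw [← closure_Ioo A.lt.ne] at ht
  exact le_on_closure (fun t ht => (A.pos t ht).le) continuousOn_const hc ht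

theorem feedback_eq (S : IsSwitchingSystem u₁ u₂ T p₀ D x₁ x₂ u W V)
    (A : IsArc u₁ u₂ T u W κ ε a b) {t : ℝ} (ht : t ∈ Icc a b) :
    feedback u₁ u₂ (W t) = κ * W t := by
  have h := S.sign_switching A ht
  rcases A.sign with ⟨rfl, rfl⟩ | ⟨rfl, rfl⟩
  · exact feedback_of_nonneg (by linarith)
  · exact feedback_of_nonpos (by linarith)

theorem switching_formula (S : IsSwitchingSystem u₁ u₂ T p₀ D x₁ x₂ u W V)
    (A : IsArc u₁ u₂ T u W κ ε a b) (hκ : 0 < κ) {t : ℝ} (ht : t ∈ Icc a b) :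
    W t = p₀ / (2 * κ) + (W a - p₀ / (2 * κ)) * Real.cos (2 * √κ * (t - a)) +
        V a / (2 * √κ) * Real.sin (2 * √κ * (t - a)) ∧
      V t = -(W a - p₀ / (2 * κ)) * (2 * √κ) * Real.sin (2 * √κ * (t - a)) +
        V a * Real.cos (2 * √κ * (t - a)) := by
  refine oscillator_formula (by positivity)
    (fun t ht => (S.hasDeriv_switching t (A.subset ht)).mono A.subset) (fun t ht => ?_) ht
  refine ((S.hasDeriv_velocity t (A.subset ht)).mono A.subset).congr_deriv ?_
  rw [S.feedback_eq A ht, mul_pow, Real.sq_sqrt hκ.le]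
  field_simp
  ring

/-- The switching function is periodic on arcs with constant control. -/
theorem switching_add_period (S : IsSwitchingSystem u₁ u₂ T p₀ D x₁ x₂ u W V)
    (A : IsArc u₁ u₂ T u W κ ε a b) (hκ : 0 < κ) {t : ℝ} (ht : t ∈ Icc a b)
    (ht' : t + Real.pi / √κ ∈ Icc a b) : W (t + Real.pi / √κ) = W t := by
  have hs : √κ ≠ 0 := by positivity
  have e : 2 * √κ * (t + Real.pi / √κ - a) = 2 * √κ * (t - a) + 2 * Real.pi := by
    field_simp
    ring
  rw [(S.switching_formula A hκ ht').1, (S.switching_formula A hκ ht).1, e, Real.cos_add_two_pi,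
    Real.sin_add_two_pi]

/-- One full period after `a` the function `W` would vanish again, inside the arc or at `b`. -/
theorem angle_lt_of_left (S : IsSwitchingSystem u₁ u₂ T p₀ D x₁ x₂ u W V)
    (A : IsArc u₁ u₂ T u W κ ε a b) (hκ : 0 < κ) (ha : W a = 0) (hb : W b ≠ 0) :
    2 * √κ * (b - a) < 2 * Real.pi := by
  have hs : 0 < √κ := by positivity
  have hp : 0 < Real.pi / √κ := by positivity
  by_contra hge
  have hle : a + Real.pi / √κ ≤ b := by
    have : Real.pi / √κ ≤ b - a := by
      rw [div_le_iff₀ hs]; linarith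
    linarith
  have h := S.switching_add_period A hκ A.left_mem ⟨by linarith, hle⟩
  rw [ha] at h
  rcases hle.eq_or_lt with hle | hle
  · exact hb (hle ▸ h)
  · exact A.ne_zero ⟨by linarith, hle⟩ h

theorem angle_lt_of_right (S : IsSwitchingSystem u₁ u₂ T p₀ D x₁ x₂ u W V)
    (A : IsArc u₁ u₂ T u W κ ε a b) (hκ : 0 < κ) (ha : W a ≠ 0) (hb : W b = 0) :
    2 * √κ * (b - a) < 2 * Real.pi := by
  have hs : 0 < √κ := by positivity
  have hp : 0 < Real.pi / √κ := by positivity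
  by_contra hge
  have hle : a ≤ b - Real.pi / √κ := by
    have : Real.pi / √κ ≤ b - a := by
      rw [div_le_iff₀ hs]; linarith
    linarith
  have h := S.switching_add_period A hκ (t := b - Real.pi / √κ) ⟨hle, by linarith⟩
    (by rw [sub_add_cancel]; exact A.right_mem)
  rw [sub_add_cancel, hb] at h
  rcases hle.eq_or_lt with hle | hle
  · exact ha (by rw [hle]; exact h.symm)
  · exact A.ne_zero ⟨hle, by linarith⟩ h.symm

theorem velocity_left (S : IsSwitchingSystem u₁ u₂ T p₀ D x₁ x₂ u W V)
    (A : IsArc u₁ u₂ T u W κ ε a b) (ha : W a = 0) : 0 < ε * V a := by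
  have hm := A.subset A.left_mem
  refine lt_of_le_of_ne (deriv_nonneg_of_pos_right A.lt
    (((S.hasDeriv_switching a hm).mono A.subset).const_mul ε) (by simp [ha])
    fun t ht => (A.pos t ht).le) (Ne.symm (mul_ne_zero ?_ (S.velocity_ne_zero a hm ha)))
  rintro rfl
  simpa using A.sign_sq

theorem velocity_right (S : IsSwitchingSystem u₁ u₂ T p₀ D x₁ x₂ u W V)
    (A : IsArc u₁ u₂ T u W κ ε a b) (hb : W b = 0) : ε * V b < 0 := by
  have hm := A.subset A.right_mem
  refine lt_of_le_of_ne (deriv_nonpos_of_pos_left A.lt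
    (((S.hasDeriv_switching b hm).mono A.subset).const_mul ε) (by simp [hb])
    fun t ht => (A.pos t ht).le) (mul_ne_zero ?_ (S.velocity_ne_zero b hm hb))
  rintro rfl
  simpa using A.sign_sq

theorem hasDeriv_state_snd (S : IsSwitchingSystem u₁ u₂ T p₀ D x₁ x₂ u W V)
    (A : IsArc u₁ u₂ T u W κ ε a b) {t : ℝ} (ht : t ∈ Icc a b) :
    HasDerivWithinAt x₂ (accel (x₁ t) κ) (Icc a b) t := by
  have hc : ContinuousOn x₁ (Icc a b) := fun t ht =>
    ((S.hasDeriv_state t (A.subset ht)).mono A.subset).continuousWithinAt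
  have hne : ∀ t ∈ Icc a b, x₁ t ^ 3 ≠ 0 := fun t ht =>
    pow_ne_zero 3 (S.trajectory.pos t (A.subset ht)).ne'
  refine hasDerivWithinAt_of_absolutelyContinuous (g := fun t => accel (x₁ t) κ) A.lt.le
    (S.trajectory.absCont₂.mono ?_) ?_ ?_ ht
  · rw [uIcc_of_le A.lt.le, uIcc_of_le S.time_pos.le]
    exact A.subset
  · exact (continuousOn_const.mul hc).add (continuousOn_const.div (hc.pow 3) hne)
  · filter_upwards [S.trajectory.hasDerivAt₂, A.control] with t h1 h2 ht
    rw [← h2 ht]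
    exact h1 (A.subset (Ioo_subset_Icc_self ht))

theorem state_energy (S : IsSwitchingSystem u₁ u₂ T p₀ D x₁ x₂ u W V)
    (A : IsArc u₁ u₂ T u W κ ε a b) {t : ℝ} (ht : t ∈ Icc a b) :
    x₂ t ^ 2 + κ * x₁ t ^ 2 + 1 / x₁ t ^ 2 = x₂ a ^ 2 + κ * x₁ a ^ 2 + 1 / x₁ a ^ 2 := by
  refine eq_left_of_hasDerivWithinAt_zero (b := b)
    (f := fun t => x₂ t ^ 2 + κ * x₁ t ^ 2 + 1 / x₁ t ^ 2) (fun t ht => ?_) ht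
  have hx := (S.trajectory.pos t (A.subset ht)).ne'
  have h1 := (S.hasDeriv_state t (A.subset ht)).mono A.subset
  have h2 := S.hasDeriv_state_snd A ht
  refine (((h2.pow 2).add ((h1.pow 2).const_mul κ)).add
    ((hasDerivWithinAt_const t _ (1 : ℝ)).div (h1.pow 2) (pow_ne_zero 2 hx))).congr_deriv ?_
  simp only [accel, Pi.pow_apply]
  field_simp
  push_cast
  ring

/-- The Ermakov equation linearizes under squaring: by conservation of `E`, `(x₁²)'' = 2 E - 4 κ
x₁²`. -/
theorem state_formula (S : IsSwitchingSystem u₁ u₂ T p₀ D x₁ x₂ u W V)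
    (A : IsArc u₁ u₂ T u W κ ε a b) (hκ : 0 < κ) {E : ℝ}
    (hE : x₂ a ^ 2 + κ * x₁ a ^ 2 + 1 / x₁ a ^ 2 = E) {t : ℝ} (ht : t ∈ Icc a b) :
    x₁ t ^ 2 = E / (2 * κ) + (x₁ a ^ 2 - E / (2 * κ)) * Real.cos (2 * √κ * (t - a)) +
        2 * x₁ a * x₂ a / (2 * √κ) * Real.sin (2 * √κ * (t - a)) ∧
      2 * x₁ t * x₂ t = -(x₁ a ^ 2 - E / (2 * κ)) * (2 * √κ) * Real.sin (2 * √κ * (t - a)) +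
        2 * x₁ a * x₂ a * Real.cos (2 * √κ * (t - a)) := by
  refine oscillator_formula (f := fun t => x₁ t ^ 2) (g := fun t => 2 * x₁ t * x₂ t)
    (by positivity) (fun t ht => ?_) (fun t ht => ?_) ht
  · refine (((S.hasDeriv_state t (A.subset ht)).mono A.subset).pow 2).congr_deriv ?_
    push_cast
    ring
  · have hx := (S.trajectory.pos t (A.subset ht)).ne'
    refine ((((S.hasDeriv_state t (A.subset ht)).mono A.subset).const_mul 2).mul
      (S.hasDeriv_state_snd A ht)).congr_deriv ?_
    rw [← hE, ← S.state_energy A ht, mul_pow, Real.sq_sqrt hκ.le]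
    simp only [accel]
    field_simp
    ring

/-- Between two consecutive switchings the angle covered by the oscillation depends only on the
ratio of the two multiplier invariants. -/
theorem angle_of_full_arc (S : IsSwitchingSystem u₁ u₂ T p₀ D x₁ x₂ u W V)
    (A : IsArc u₁ u₂ T u W κ ε a b) (hκ : 0 < κ) (ha : W a = 0) (hb : W b = 0) :
    (p₀ ^ 2 / D + κ) * Real.cos (2 * √κ * (b - a)) = p₀ ^ 2 / D - κ ∧
      V a * ((p₀ ^ 2 / D + κ) * Real.sin (2 * √κ * (b - a))) = -(2 * √κ * p₀) := by
  have hma := A.subset A.left_mem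
  have hmb := A.subset A.right_mem
  have hD := S.energy_pos hma ha
  have h1 := S.velocity_left A ha
  have h2 := S.velocity_right A hb
  -- Both squares equal `D`, while `W` leaves zero at `a` and returns to it at `b`, so the slopes
  -- have opposite signs.
  have hV : V b = -V a := by
    have h3 := (S.sq_velocity hmb hb).trans (S.sq_velocity hma ha).symm
    rcases sq_eq_sq_iff_eq_or_eq_neg.mp h3 with h | h
    · rw [h] at h2; linarith
    · exact h
  obtain ⟨f1, f2⟩ := S.switching_formula A hκ A.right_mem
  rw [ha, hb] at f1
  rw [ha, hV] at f2
  set C := Real.cos (2 * √κ * (b - a))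
  set R := Real.sin (2 * √κ * (b - a))
  have hq : √κ ^ 2 = κ := Real.sq_sqrt hκ.le
  have hs : 0 < √κ := by positivity
  generalize √κ = q at *
  subst hq
  have hVa := S.sq_velocity hma ha
  have hV0 := S.velocity_ne_zero a hma ha
  field_simp at f1 f2
  rw [← hVa] at hD ⊢
  field_simp
  constructor
  · linear_combination p₀ * f1 - V a * q * f2
  · linear_combination (-V a * q) * f1 - p₀ * f2

theorem angle_lt_of_full_arc (S : IsSwitchingSystem u₁ u₂ T p₀ D x₁ x₂ u W V)
    (A : IsArc u₁ u₂ T u W κ ε a b) (hκ : 0 < κ) (ha : W a = 0) (hb : W b = 0) :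
    2 * √κ * (b - a) < 2 * Real.pi := by
  have hs : 0 < √κ := by positivity
  have hp : 0 < Real.pi / √κ := by positivity
  by_contra hge
  have hle : a + Real.pi / √κ ≤ b := by
    have : Real.pi / √κ ≤ b - a := by
      rw [div_le_iff₀ hs]; linarith
    linarith
  rcases hle.eq_or_lt with hle | hle
  -- Periodicity does not exclude exactly one period; there the cosine is `1`, which would give `s +
  -- κ = s - κ`.
  · have h := (S.angle_of_full_arc A hκ ha hb).1
    rw [← hle, add_sub_cancel_left, show 2 * √κ * (Real.pi / √κ) = 2 * Real.pi by field_simp,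
      Real.cos_two_pi] at h
    linarith
  · have h := S.switching_add_period A hκ A.left_mem ⟨by linarith, hle.le⟩
    exact A.ne_zero ⟨by linarith, hle⟩ (h.trans ha)

/-- By energy conservation both squares are roots of `(s + κ) y² - E y + 1`, but this does not tell
which ones. Inserting the angle of the arc into the oscillation of `x₁²` shows that their product is
the product of the two roots. -/
theorem state_of_full_arc (S : IsSwitchingSystem u₁ u₂ T p₀ D x₁ x₂ u W V)
    (A : IsArc u₁ u₂ T u W κ ε a b) (hκ : 0 < κ) (ha : W a = 0) (hb : W b = 0) :
    (p₀ ^ 2 / D + κ) * x₁ a ^ 2 * x₁ b ^ 2 = 1 := by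
  have hma := A.subset A.left_mem
  have hD := S.energy_pos hma ha
  obtain ⟨hC, hR⟩ := S.angle_of_full_arc A hκ ha hb
  have hf := (S.state_formula A hκ rfl A.right_mem).1
  have hx2 := S.sq_state_snd hma ha
  have hv := S.velocity_mul hma ha
  have hV := S.sq_velocity hma ha
  have hx := (S.trajectory.pos a hma).ne'
  have hV0 := S.velocity_ne_zero a hma ha
  have hs : 0 < √κ := by positivity
  have hκs : 0 < p₀ ^ 2 / D + κ := by positivity
  set s := p₀ ^ 2 / D with hsdef
  have hsD : s * D = p₀ ^ 2 := by rw [hsdef]; field_simp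
  have hxV : x₂ a * p₀ = s * x₁ a * V a := by
    refine mul_right_cancel₀ hV0 ?_
    linear_combination p₀ * hv - s * x₁ a * hV - x₁ a * hsD
  have hxR : x₂ a * ((s + κ) * Real.sin (2 * √κ * (b - a))) = -(2 * √κ * s * x₁ a) := by
    refine mul_left_cancel₀ hV0 ?_
    linear_combination x₂ a * hR - 2 * √κ * hxV
  have h1 : (s + κ) * x₁ b ^ 2 = 1 / x₁ a ^ 2 := by
    rw [hf, hx2]
    set E := s * x₁ a ^ 2 + κ * x₁ a ^ 2 + 1 / x₁ a ^ 2 with hE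
    have e1 : x₁ a / √κ * √κ = x₁ a := by field_simp
    have e2 : E / (2 * κ) * (2 * κ) = E := by field_simp
    have e3 : 2 * x₁ a * x₂ a / (2 * √κ) = x₁ a / √κ * x₂ a := by field_simp
    rw [e3]
    linear_combination (x₁ a ^ 2 - E / (2 * κ)) * hC + x₁ a / √κ * hxR - 2 * s * x₁ a * e1 + e2 + hE
  rw [mul_right_comm, h1, one_div_mul_cancel (pow_ne_zero 2 hx)]

/-- Here `V a > 0` and `p₀ ≤ 0` make the sine of the angle nonnegative, so the angle is the
arccosine itself. On a `Y`-arc `V a < 0` reverses the sign, whence the `2π - arccos` in `timeY`. -/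
theorem duration_of_full_arc_pos (S : IsSwitchingSystem u₁ u₂ T p₀ D x₁ x₂ u W V)
    (A : IsArc u₁ u₂ T u W u₁ 1 a b) (hu₁ : 0 < u₁) (ha : W a = 0) (hb : W b = 0) :
    b - a = timeX u₁ (p₀ ^ 2 / D) := by
  have hD := S.energy_pos (A.subset A.left_mem) ha
  obtain ⟨hC, hR⟩ := S.angle_of_full_arc A hu₁ ha hb
  have hV := S.velocity_left A ha
  have hs : 0 < √u₁ := by positivity
  have hss : 0 < p₀ ^ 2 / D + u₁ := by positivity
  have hsin : 0 ≤ Real.sin (2 * √u₁ * (b - a)) := by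
    by_contra hneg
    have h1 := mul_neg_of_pos_of_neg (by simpa using hV)
      (mul_neg_of_pos_of_neg hss (not_le.mp hneg))
    rw [hR] at h1
    have := mul_nonneg hs.le (neg_nonneg.mpr S.nonpos)
    linarith
  rw [timeX, ← (eq_div_iff hss.ne').mpr ((mul_comm _ _).trans hC), arccos_cos_of_sin_nonneg
    (mul_nonneg (by positivity) (sub_nonneg.mpr A.lt.le))
    (S.angle_lt_of_full_arc A hu₁ ha hb) hsin]
  field_simp

theorem duration_of_full_arc_neg (S : IsSwitchingSystem u₁ u₂ T p₀ D x₁ x₂ u W V)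
    (A : IsArc u₁ u₂ T u W u₂ (-1) a b) (hu₂ : 0 < u₂) (ha : W a = 0) (hb : W b = 0) :
    b - a = timeY u₂ (p₀ ^ 2 / D) := by
  have hD := S.energy_pos (A.subset A.left_mem) ha
  obtain ⟨hC, hR⟩ := S.angle_of_full_arc A hu₂ ha hb
  have hV := S.velocity_left A ha
  have hs : 0 < √u₂ := by positivity
  have hss : 0 < p₀ ^ 2 / D + u₂ := by positivity
  have hsin : Real.sin (2 * √u₂ * (b - a)) ≤ 0 := by
    by_contra hneg
    have h1 := mul_neg_of_neg_of_pos (a := V a) (by linarith) (mul_pos hss (not_le.mp hneg))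
    rw [hR] at h1
    have := mul_nonneg hs.le (neg_nonneg.mpr S.nonpos)
    linarith
  rw [timeY, ← (eq_div_iff hss.ne').mpr ((mul_comm _ _).trans hC), arccos_cos_of_sin_nonpos
    (mul_pos (by positivity) (sub_pos.mpr A.lt))
    (S.angle_lt_of_full_arc A hu₂ ha hb).le hsin]
  field_simp
  ring

/-- The first arc, starting in a turning point of the oscillation. -/
theorem initial_arc (S : IsSwitchingSystem u₁ u₂ T p₀ D x₁ x₂ u W V)
    (A : IsArc u₁ u₂ T u W κ ε 0 b) (hκ : 0 < κ) (hp₀ : p₀ < 0) (hε : 0 < ε * (1 - κ))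
    (h1 : x₁ 0 = 1) (h2 : x₂ 0 = 0) (ha : W 0 ≠ 0) (hb : W b = 0) :
    b = 1 / (2 * √κ) * Real.arccos ((2 * κ * x₁ b ^ 2 - (κ + 1)) / (κ - 1)) := by
  have hmb := A.subset A.right_mem
  have hκ1 : κ - 1 ≠ 0 := by
    intro h
    rw [show 1 - κ = 0 by linarith] at hε
    simp at hε
  have hs : 0 < √κ := by positivity
  have hθ := S.angle_lt_of_right A hκ ha hb
  obtain ⟨f1, f2⟩ := S.state_formula A hκ (E := κ + 1) (by rw [h1, h2]; ring) A.right_mem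
  have hVb := S.velocity_right A hb
  have hx := S.trajectory.pos b hmb
  -- At the switching `V x₂ = p₀ x₁ < 0` and `ε V < 0`: an initial `X`-arc ends moving right, an
  -- initial `Y`-arc moving left. This fixes the sign of the sine.
  have hxb : 0 < ε * x₂ b := by
    have h := S.velocity_mul hmb hb
    have h3 : (ε * V b) * (ε * x₂ b) < 0 := by
      have : (ε * V b) * (ε * x₂ b) = p₀ * x₁ b := by
        linear_combination ε ^ 2 * h + p₀ * x₁ b * A.sign_sq
      rw [this]
      exact mul_neg_of_neg_of_pos hp₀ hx
    exact pos_of_mul_neg_right h3 hVb.le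
  rw [h1, h2, sub_zero] at f1 f2
  rw [sub_zero] at hθ
  have hsin : 0 ≤ Real.sin (2 * √κ * b) := by
    by_contra hneg
    have e : 2 * κ * x₁ b * (ε * x₂ b) = ε * (1 - κ) * √κ * Real.sin (2 * √κ * b) := by
      have : 2 * x₁ b * x₂ b = (1 - κ) / κ * √κ * Real.sin (2 * √κ * b) := by
        rw [f2]; field_simp; ring
      field_simp at this
      linear_combination ε * this
    have h3 : 0 < 2 * κ * x₁ b * (ε * x₂ b) := by positivity
    rw [e] at h3
    have := mul_neg_of_pos_of_neg (mul_pos hε hs) (not_le.mp hneg)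
    linarith
  have hcos : (2 * κ * x₁ b ^ 2 - (κ + 1)) / (κ - 1) = Real.cos (2 * √κ * b) := by
    rw [f1]
    field_simp
    ring
  rw [hcos, arccos_cos_of_sin_nonneg (mul_nonneg (by positivity) A.lt.le) hθ hsin]
  field_simp

/-- The last arc, ending in a turning point of the oscillation. -/
theorem final_arc (S : IsSwitchingSystem u₁ u₂ T p₀ D x₁ x₂ u W V) {γ : ℝ}
    (A : IsArc u₁ u₂ T u W u₂ (-1) a T) (hu₂ : 0 < u₂) (hp₀ : p₀ < 0)
    (hγ : 0 < u₂ * γ ^ 2 - 1 / γ ^ 2)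
    (h1 : x₁ T = γ) (h2 : x₂ T = 0) (ha : W a = 0) (hb : W T ≠ 0) :
    T - a = 1 / (2 * √u₂) *
      Real.arccos ((2 * u₂ * x₁ a ^ 2 - cFin u₂ γ) / (u₂ * γ ^ 2 - 1 / γ ^ 2)) := by
  have hma := A.subset A.left_mem
  have hs : 0 < √u₂ := by positivity
  have hθ := S.angle_lt_of_left A hu₂ ha hb
  have hE := S.state_energy A A.right_mem
  obtain ⟨f1, f2⟩ := S.state_formula A hu₂ hE.symm A.right_mem
  have hVa := S.velocity_left A ha
  have hx := S.trajectory.pos a hma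
  have hxa : 0 < x₂ a := by
    have h := S.velocity_mul hma ha
    have h3 : V a * x₂ a < 0 := by
      rw [h]
      exact mul_neg_of_neg_of_pos hp₀ hx
    exact pos_of_mul_neg_right h3 (by linarith)
  rw [h1, h2] at f1 f2
  have hc : (0:ℝ) ^ 2 + u₂ * γ ^ 2 + 1 / γ ^ 2 = cFin u₂ γ := by rw [cFin]; ring
  rw [hc] at f1 f2
  have hsc := Real.sin_sq_add_cos_sq (2 * √u₂ * (T - a))
  set θ := 2 * √u₂ * (T - a)
  have hm : γ ^ 2 - cFin u₂ γ / (2 * u₂) = (u₂ * γ ^ 2 - 1 / γ ^ 2) / (2 * u₂) := by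
    rw [cFin]; field_simp; ring
  have e : 2 * x₁ a * x₂ a / (2 * √u₂) * (2 * √u₂) = 2 * x₁ a * x₂ a := by field_simp
  -- The oscillation formula runs from `a` to `T`; inverting the rotation by `θ` expresses the state
  -- at `a` through the turning point at `T`.
  have f3 : 2 * x₁ a * x₂ a / (2 * √u₂) * Real.cos θ =
      (x₁ a ^ 2 - cFin u₂ γ / (2 * u₂)) * Real.sin θ := by
    refine mul_right_cancel₀ (b := 2 * √u₂) (by positivity) ?_
    linear_combination Real.cos θ * e - f2
  have g1 : x₁ a ^ 2 - cFin u₂ γ / (2 * u₂) = (γ ^ 2 - cFin u₂ γ / (2 * u₂)) * Real.cos θ := by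
    linear_combination (-Real.cos θ) * f1 - Real.sin θ * f3
      - (x₁ a ^ 2 - cFin u₂ γ / (2 * u₂)) * hsc
  have g2 : 2 * x₁ a * x₂ a / (2 * √u₂) = (γ ^ 2 - cFin u₂ γ / (2 * u₂)) * Real.sin θ := by
    linear_combination (-Real.sin θ) * f1 + Real.cos θ * f3
      - 2 * x₁ a * x₂ a / (2 * √u₂) * hsc
  rw [hm] at g1 g2
  have hsin : 0 ≤ Real.sin θ := by
    by_contra hneg
    have h3 : 0 < 2 * x₁ a * x₂ a / (2 * √u₂) := by positivity
    rw [g2] at h3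
    have := mul_neg_of_pos_of_neg (a := (u₂ * γ ^ 2 - 1 / γ ^ 2) / (2 * u₂)) (by positivity)
      (not_le.mp hneg)
    linarith
  have hcos : (2 * u₂ * x₁ a ^ 2 - cFin u₂ γ) / (u₂ * γ ^ 2 - 1 / γ ^ 2) = Real.cos θ := by
    rw [div_eq_iff hγ.ne']
    generalize u₂ * γ ^ 2 - 1 / γ ^ 2 = K at *
    field_simp at g1
    linear_combination g1
  rw [hcos, arccos_cos_of_sin_nonneg (mul_nonneg (by positivity) (sub_nonneg.mpr A.lt.le)) hθ hsin]
  field_simp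

end IsSwitchingSystem

end

section

/-! ### Bang-bang structure -/

theorem le_of_forall_lt_succ {τ : ℕ → ℝ} {N j k : ℕ} (h : ∀ k ≤ N, τ k < τ (k + 1))
    (hjk : j ≤ k) (hk : k ≤ N + 1) : τ j ≤ τ k := by
  induction k, hjk using Nat.le_induction with
  | base => exact le_rfl
  | succ k hjk ih => exact (ih (by omega)).trans (h k (by omega)).le

/-- The first and second control of a bang-bang control, with the sign of the switching function
belonging to the first one. -/
def IsControlPair (u₁ u₂ α β ε : ℝ) : Prop :=
  (ε = 1 ∧ α = u₁ ∧ β = u₂) ∨ (ε = -1 ∧ α = u₂ ∧ β = u₁)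

theorem IsControlPair.sign {u₁ u₂ α β ε : ℝ} (h : IsControlPair u₁ u₂ α β ε) (k : ℕ) :
    ((-1) ^ k * ε = 1 ∧ (if Even k then α else β) = u₁) ∨
      ((-1) ^ k * ε = -1 ∧ (if Even k then α else β) = u₂) := by
  rcases h with ⟨rfl, rfl, rfl⟩ | ⟨rfl, rfl, rfl⟩ <;> rcases Nat.even_or_odd k with hk | hk
  · exact Or.inl ⟨by simp [hk], by simp [hk]⟩
  · exact Or.inr ⟨by simp [hk.neg_one_pow], by simp [Nat.not_even_iff_odd.mpr hk]⟩
  · exact Or.inr ⟨by simp [hk], by simp [hk]⟩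
  · exact Or.inl ⟨by simp [hk.neg_one_pow], by simp [Nat.not_even_iff_odd.mpr hk]⟩

/-- The intervals between consecutive `τ k` are arcs with alternating controls. -/
structure IsArcChain (u₁ u₂ T : ℝ) (u W : ℝ → ℝ) (α β ε : ℝ) (N : ℕ) (τ : ℕ → ℝ) : Prop where
  initial : τ 0 = 0
  final : τ (N + 1) = T
  pair : IsControlPair u₁ u₂ α β ε
  arc : ∀ k ≤ N, IsArc u₁ u₂ T u W (if Even k then α else β) ((-1) ^ k * ε) (τ k) (τ (k + 1))
  switching : ∀ k, 1 ≤ k → k ≤ N → W (τ k) = 0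

variable {u₁ u₂ T p₀ D : ℝ} {x₁ x₂ u W V : ℝ → ℝ} {κ ε a b : ℝ}

/-- Recovers the sign of `W` from a prescribed form of the control. Where `ε W < 0` the control has
the other value; this set is open and null, hence empty. An interior zero would be a local minimum
of `ε W`, against simplicity. -/
theorem IsSwitchingSystem.sign_of_control (S : IsSwitchingSystem u₁ u₂ T p₀ D x₁ x₂ u W V)
    (hne : u₁ ≠ u₂) (ha : 0 ≤ a) (hb : b ≤ T) (hκ : (ε = 1 ∧ κ = u₁) ∨ (ε = -1 ∧ κ = u₂))
    (hu : ∀ᵐ t, t ∈ Ioo a b → u t = κ) {t : ℝ} (ht : t ∈ Ioo a b) : 0 < ε * W t := by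
  have hsub : Ioo a b ⊆ Icc 0 T := fun t ht => ⟨ha.trans ht.1.le, ht.2.le.trans hb⟩
  have hnonneg : ∀ t ∈ Ioo a b, 0 ≤ ε * W t := by
    intro t ht
    by_contra hneg
    have hc : ContinuousOn (fun t => ε * W t) (Ioo a b) :=
      continuousOn_const.mul (S.continuousOn_switching.mono hsub)
    have hopen := hc.isOpen_inter_preimage isOpen_Ioo (isOpen_Iio (a := (0 : ℝ)))
    refine (hopen.measure_pos volume ⟨t, ht, not_le.mp hneg⟩).ne' ?_
    rw [measure_eq_zero_iff_ae_notMem]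
    filter_upwards [hu, S.control] with r h1 h2 hr
    have h1 := h1 hr.1
    have h2 := h2 (hsub hr.1)
    have h3 : ε * W r < 0 := hr.2
    rcases hκ with ⟨rfl, rfl⟩ | ⟨rfl, rfl⟩
    · exact hne (h1.symm.trans (h2.2 (by linarith)))
    · exact hne ((h2.1 (by linarith)).symm.trans h1)
  refine lt_of_le_of_ne (hnonneg t ht) fun h0 => ?_
  have hε : ε ≠ 0 := by rcases hκ with ⟨rfl, -⟩ | ⟨rfl, -⟩ <;> norm_num
  have hW : W t = 0 := by simpa [hε] using h0.symm
  have hnhds : Ioo a b ∈ 𝓝 t := isOpen_Ioo.mem_nhds ht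
  have hd : HasDerivAt (fun t => ε * W t) (ε * V t) t :=
    ((S.hasDeriv_switching t (hsub ht)).hasDerivAt (mem_of_superset hnhds hsub)).const_mul ε
  have hmin : IsLocalMin (fun t => ε * W t) t := by
    filter_upwards [hnhds] with r hr
    rw [← h0]
    exact hnonneg r hr
  exact mul_ne_zero hε (S.velocity_ne_zero t (hsub ht) hW) (hmin.hasDerivAt_eq_zero hd)

theorem IsSwitchingSystem.exists_arcChain (S : IsSwitchingSystem u₁ u₂ T p₀ D x₁ x₂ u W V)
    (hne : u₁ ≠ u₂) {α β : ℝ} {N : ℕ} (hpair : IsControlPair u₁ u₂ α β ε)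
    (h : IsBangBang T u α β N) : ∃ τ, IsArcChain u₁ u₂ T u W α β ε N τ := by
  obtain ⟨τ, h0, hN, hlt, hu⟩ := h
  have hmono := fun j k => le_of_forall_lt_succ (j := j) (k := k) hlt
  have harc : ∀ k ≤ N,
      IsArc u₁ u₂ T u W (if Even k then α else β) ((-1) ^ k * ε) (τ k) (τ (k + 1)) := by
    intro k hk
    have ha : 0 ≤ τ k := h0 ▸ hmono 0 k (Nat.zero_le k) (by omega)
    have hb : τ (k + 1) ≤ T := hN ▸ hmono (k + 1) (N + 1) (by omega) le_rfl
    exact ⟨ha, hlt k hk, hb, hpair.sign k, hu k hk,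
      fun t ht => S.sign_of_control hne ha hb (hpair.sign k) (hu k hk) ht⟩
  refine ⟨τ, h0, hN, hpair, harc, fun k hk hkN => ?_⟩
  obtain ⟨k, rfl⟩ : ∃ j, k = j + 1 := ⟨k - 1, by omega⟩
  have A := harc k (by omega)
  have B := harc (k + 1) hkN
  have h1 := S.sign_switching A A.right_mem
  have h2 := S.sign_switching B B.left_mem
  rw [pow_succ] at h2
  have h3 : (-1) ^ k * ε * W (τ (k + 1)) = 0 := by linarith
  refine (mul_eq_zero.mp h3).resolve_left fun h4 => ?_
  have := A.sign_sq
  rw [h4] at this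
  norm_num at this

theorem IsSwitchingSystem.exists_isBangBang (S : IsSwitchingSystem u₁ u₂ T p₀ D x₁ x₂ u W V) :
    ∃ (α β ε : ℝ) (N : ℕ), IsControlPair u₁ u₂ α β ε ∧ IsBangBang T u α β N := by
  have h0m : (0 : ℝ) ∈ Icc 0 T := ⟨le_rfl, S.time_pos.le⟩
  obtain ⟨ε, hε, hev⟩ : ∃ ε : ℝ, (ε = 1 ∨ ε = -1) ∧ ∀ᶠ t in 𝓝[>] (0 : ℝ), 0 < ε * W t := by
    -- The first control is decided by the sign of `W` just after time `0`, that is by `W 0`, or by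
    -- `V 0` if `W 0 = 0`.
    have key : ∀ ε : ℝ, 0 < ε * W 0 ∨ (W 0 = 0 ∧ 0 < ε * V 0) →
        ∀ᶠ t in 𝓝[>] (0 : ℝ), 0 < ε * W t := by
      rintro ε (h | ⟨h, h'⟩)
      · have hc : ContinuousWithinAt (fun t => ε * W t) (Ioc 0 T) 0 :=
          continuousWithinAt_const.mul
            ((S.continuousOn_switching 0 h0m).mono Ioc_subset_Icc_self)
        rw [ContinuousWithinAt, nhdsWithin_Ioc_eq_nhdsGT S.time_pos] at hc
        exact hc.eventually_const_lt h
      · exact eventually_pos_of_hasDerivWithinAt_pos S.time_pos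
          ((S.hasDeriv_switching 0 h0m).const_mul ε) (by simp [h]) h'
    rcases lt_trichotomy (W 0) 0 with h | h | h
    · exact ⟨-1, Or.inr rfl, key _ (Or.inl (by linarith))⟩
    · rcases lt_or_gt_of_ne (S.velocity_ne_zero 0 h0m h) with hV | hV
      · exact ⟨-1, Or.inr rfl, key _ (Or.inr ⟨h, by linarith⟩)⟩
      · exact ⟨1, Or.inl rfl, key _ (Or.inr ⟨h, by linarith⟩)⟩
    · exact ⟨1, Or.inl rfl, key _ (Or.inl (by linarith))⟩
  have hε0 : ε ≠ 0 := by rcases hε with rfl | rfl <;> norm_num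
  have hd : ∀ t ∈ Icc 0 T, HasDerivWithinAt (fun t => ε * W t) (ε * V t) (Icc 0 T) t :=
    fun t ht => (S.hasDeriv_switching t ht).const_mul ε
  have hs : ∀ t ∈ Icc 0 T, ε * W t = 0 → ε * V t ≠ 0 := fun t ht h =>
    mul_ne_zero hε0 (S.velocity_ne_zero t ht ((mul_eq_zero.mp h).resolve_left hε0))
  have hfin : {t ∈ Ioo 0 T | ε * W t = 0}.Finite :=
    (finite_zeros_of_deriv_ne_zero hd hs).subset fun t ht => ⟨Ioo_subset_Icc_self ht.1, ht.2⟩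
  obtain ⟨τ, h0, hN, hlt, hτ⟩ := exists_alternating_partition _ S.time_pos hd
    (fun t ht => hs t (Ioo_subset_Icc_self ht)) hfin rfl hev
  obtain ⟨α, β, hpair⟩ : ∃ α β, IsControlPair u₁ u₂ α β ε := by
    rcases hε with rfl | rfl
    · exact ⟨u₁, u₂, Or.inl ⟨rfl, rfl, rfl⟩⟩
    · exact ⟨u₂, u₁, Or.inr ⟨rfl, rfl, rfl⟩⟩
  set N := {t ∈ Ioo 0 T | ε * W t = 0}.ncard
  have hmono := fun j k => le_of_forall_lt_succ (j := j) (k := k) hlt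
  refine ⟨α, β, ε, N, hpair, τ, h0, hN, hlt, fun k hk => ?_⟩
  filter_upwards [S.control] with t hc ht
  have hm : t ∈ Icc 0 T := ⟨(h0 ▸ hmono 0 k (Nat.zero_le k) (by omega)).trans ht.1.le,
    ht.2.le.trans (hN ▸ hmono (k + 1) (N + 1) (by omega) le_rfl)⟩
  have hpos := hτ k hk t ht
  rw [← mul_assoc] at hpos
  rcases hpair.sign k with ⟨h1, h2⟩ | ⟨h1, h2⟩ <;> rw [h1] at hpos <;> rw [h2]
  · exact (hc hm).1 (by linarith)
  · exact (hc hm).2 (by linarith)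

end

section

/-! ### The states at the switchings -/

/-- The recursion satisfied by the squares `y k` of the first coordinates at the switchings of an
extremal with controls `κ 0, …, κ N`. -/
structure IsSwitchingSequence (u₁ u₂ γ s : ℝ) (N : ℕ) (κ y : ℕ → ℝ) : Prop where
  alternating : ∀ k, (κ k = u₁ ∧ κ (k + 1) = u₂) ∨ (κ k = u₂ ∧ κ (k + 1) = u₁)
  pos : ∀ k, k ≤ N → 0 < y k
  initial : 1 ≤ N → (s + κ 0) * y 1 ^ 2 - (κ 0 + 1) * y 1 + 1 = 0
  step : ∀ k, 1 ≤ k → k + 1 ≤ N → (s + κ k) * y k * y (k + 1) = 1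
  final : 1 ≤ N → (s + κ N) * y N ^ 2 - (κ N * γ ^ 2 + 1 / γ ^ 2) * y N + 1 = 0
  single : N = 0 → κ 0 + 1 = κ 0 * γ ^ 2 + 1 / γ ^ 2

variable {u₁ u₂ γ s : ℝ} {N : ℕ} {κ y : ℕ → ℝ}

theorem lt_one_of_le_inv_pow (hγ : 1 < γ) (hu₁γ : u₁ ≤ 1 / γ ^ 4) : u₁ < 1 :=
  hu₁γ.trans_lt ((div_lt_one (by positivity)).mpr (one_lt_pow₀ hγ (by norm_num)))

namespace IsSwitchingSequence

/-- A single arc joining the two turning points needs `κ = 1 / γ²`, which lies strictly between `u₁`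
and `u₂`. -/
theorem ne_zero (h : IsSwitchingSequence u₁ u₂ γ s N κ y) (hγ : 1 < γ) (hu₁γ : u₁ ≤ 1 / γ ^ 4)
    (hu₂ : 1 ≤ u₂) : N ≠ 0 := by
  intro hN
  have h1 := h.single hN
  have hg : 1 < γ ^ 2 := by nlinarith
  have h2 : (γ ^ 2 - 1) * (κ 0 * γ ^ 2 - 1) = 0 := by
    field_simp at h1
    linear_combination -h1
  have h3 : κ 0 * γ ^ 2 = 1 := by
    rcases mul_eq_zero.mp h2 with h | h <;> linarith
  rcases h.alternating 0 with ⟨hk, -⟩ | ⟨hk, -⟩ <;> rw [hk] at h3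
  · rw [le_div_iff₀ (by positivity)] at hu₁γ
    nlinarith
  · nlinarith

/-- For `s = 0` all switchings lie on the axis `x₂ = 0` and the quadratics factor. From `y ≤ 1` an
`X`-arc jumps to at least `γ⁴`, because `u₁ ≤ 1 / γ⁴`, so the target value `γ²` is skipped. -/
theorem invariant_ne_zero (h : IsSwitchingSequence u₁ u₂ γ s N κ y) (hγ : 1 < γ) (hu₁ : 0 < u₁)
    (hu₁γ : u₁ ≤ 1 / γ ^ 4) (hu₂ : 1 ≤ u₂) : s ≠ 0 := by
  rintro rfl
  have hN := h.ne_zero hγ hu₁γ hu₂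
  have hg : 1 < γ ^ 2 := by nlinarith
  have hu₁1 := lt_one_of_le_inv_pow hγ hu₁γ
  rw [le_div_iff₀ (by positivity)] at hu₁γ
  have hX : ∀ y z : ℝ, 0 < y → y ≤ 1 → 0 < z → u₁ * y * z = 1 → γ ^ 4 ≤ z := by
    intro y z hy hy1 hz e
    have h1 : u₁ * (y * z) ≤ u₁ * z := by
      have : y * z ≤ z := by nlinarith
      exact mul_le_mul_of_nonneg_left this hu₁.le
    have h2 : u₁ * γ ^ 4 ≤ u₁ * z := by linarith
    exact le_of_mul_le_mul_left h2 hu₁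
  have hY : ∀ y z : ℝ, 1 ≤ y → 0 < z → u₂ * y * z = 1 → z ≤ 1 := by
    intro y z hy hz e
    have : 1 ≤ u₂ * y := by nlinarith
    nlinarith
  -- Here `κ k` is the control used after the switching `k`: an `X`-arc starts with `y ≤ 1`, a
  -- `Y`-arc with `y = 1` or `y ≥ γ⁴`.
  have key : ∀ k, 1 ≤ k → k ≤ N →
      (κ k = u₁ → y k ≤ 1) ∧ (κ k = u₂ → y k = 1 ∨ γ ^ 4 ≤ y k) := by
    intro k hk
    have hlt : u₁ ≠ u₂ := by linarith
    induction k, hk using Nat.le_induction with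
    | base =>
      intro hN1
      have hy := h.pos 1 hN1
      have h1 : (y 1 - 1) * (κ 0 * 1 * y 1 - 1) = 0 := by linear_combination h.initial hN1
      rcases h.alternating 0 with ⟨e0, e1⟩ | ⟨e0, e1⟩ <;> rw [e0] at h1 <;> rw [zero_add] at e1
      · refine ⟨fun e => absurd (e.symm.trans e1) hlt, fun _ => ?_⟩
        rcases mul_eq_zero.mp h1 with h1 | h1
        · left; linarith
        · exact Or.inr (hX 1 _ one_pos le_rfl hy (by linarith))
      · refine ⟨fun _ => ?_, fun e => absurd (e1.symm.trans e) hlt⟩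
        rcases mul_eq_zero.mp h1 with h1 | h1
        · linarith
        · exact hY 1 _ le_rfl hy (by linarith)
    | succ k hk ih =>
      intro hkN
      obtain ⟨i1, i2⟩ := ih (by omega)
      have hy := h.pos k (by omega)
      have hy' := h.pos (k + 1) hkN
      have h1 := h.step k hk hkN
      rw [zero_add] at h1
      rcases h.alternating k with ⟨e0, e1⟩ | ⟨e0, e1⟩ <;> rw [e0] at h1
      · exact ⟨fun e => absurd (e.symm.trans e1) hlt,
          fun _ => Or.inr (hX _ _ hy (i1 e0) hy' h1)⟩
      · refine ⟨fun _ => hY _ _ ?_ hy' h1, fun e => absurd (e1.symm.trans e) hlt⟩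
        rcases i2 e0 with h | h <;> nlinarith
  have hN1 : 1 ≤ N := by omega
  obtain ⟨k1, k2⟩ := key N hN1 le_rfl
  have hf := h.final hN1
  have hy := h.pos N le_rfl
  have h1 : (y N - γ ^ 2) * (κ N * y N * γ ^ 2 - 1) = 0 := by
    field_simp at hf
    linear_combination hf
  rcases h.alternating N with ⟨e, -⟩ | ⟨e, -⟩ <;> rw [e] at h1
  · have h2 := k1 e
    rcases mul_eq_zero.mp h1 with h1 | h1
    · linarith
    · have := hX _ _ hy h2 (by linarith : 0 < γ ^ 2) (by linarith)
      nlinarith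
  · rcases mul_eq_zero.mp h1 with h1 | h1
    · rcases k2 e with h2 | h2 <;> nlinarith
    · have := hY (y N) (γ ^ 2) (by rcases k2 e with h2 | h2 <;> nlinarith) (by linarith)
        (by linarith)
      linarith

theorem first_of_pos (h : IsSwitchingSequence u₁ u₂ γ s N κ y) (hs : 0 < s) (hN : 1 ≤ N)
    (h1 : u₁ < 1) (hu₂ : 1 ≤ u₂) (hu₁ : 0 < u₁) : (κ 0 = u₁ → 1 < y 1) ∧ (κ 0 = u₂ → y 1 < 1) := by
  have hy := h.pos 1 hN
  -- Positivity of the product places `y 1` strictly between `1` and `1 / κ 0`.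
  have e : s * y 1 ^ 2 = (1 - κ 0 * y 1) * (y 1 - 1) := by linear_combination h.initial hN
  have hp : 0 < s * y 1 ^ 2 := by positivity
  rw [e] at hp
  constructor <;> intro h0 <;> rw [h0] at hp <;> by_contra hc <;> rw [not_lt] at hc
  · have : u₁ * y 1 ≤ 1 := by nlinarith
    nlinarith
  · have : 1 ≤ u₂ * y 1 := by nlinarith
    nlinarith

/-- An extremal with positive invariant does not end with an arc of control `u₁`. -/
theorem last_control (h : IsSwitchingSequence u₁ u₂ γ s N κ y) (hs : 0 < s) (hγ : 1 < γ)
    (hu₁ : 0 < u₁) (hu₁γ : u₁ ≤ 1 / γ ^ 4) (hu₂ : 1 ≤ u₂) : κ N = u₂ := by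
  have hN := h.ne_zero hγ hu₁γ hu₂
  have hN1 : 1 ≤ N := by omega
  have hg : 1 < γ ^ 2 := by nlinarith
  have hu₁1 := lt_one_of_le_inv_pow hγ hu₁γ
  rw [le_div_iff₀ (by positivity)] at hu₁γ
  -- These two bounds are passed on by the recursion. A final `X`-arc would start with `y N < 1`,
  -- and both factors in `e1` below would have opposite signs.
  have key : ∀ k, 1 ≤ k → k ≤ N →
      (κ k = u₁ → y k < 1) ∧ (κ k = u₂ → 1 < (s + u₂) * y k) := by
    have hlt : u₁ ≠ u₂ := by linarith
    intro k hk
    induction k, hk using Nat.le_induction with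
    | base =>
      intro _
      obtain ⟨i1, i2⟩ := h.first_of_pos hs hN1 hu₁1 hu₂ hu₁
      rcases h.alternating 0 with ⟨e0, e1⟩ | ⟨e0, e1⟩ <;> rw [zero_add] at e1
      · refine ⟨fun e => absurd (e.symm.trans e1) hlt, fun _ => ?_⟩
        nlinarith [i1 e0]
      · exact ⟨fun _ => i2 e0, fun e => absurd (e1.symm.trans e) hlt⟩
    | succ k hk ih =>
      intro hkN
      obtain ⟨i1, i2⟩ := ih (by omega)
      have hy := h.pos k (by omega)
      have hy' := h.pos (k + 1) hkN
      have h1 := h.step k hk hkN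
      rcases h.alternating k with ⟨e0, e1⟩ | ⟨e0, e1⟩ <;> rw [e0] at h1
      · refine ⟨fun e => absurd (e.symm.trans e1) hlt, fun _ => ?_⟩
        have h2 := i1 e0
        have h3 : (s + u₁) * y (k + 1) * y k < (s + u₁) * y (k + 1) * 1 :=
          mul_lt_mul_of_pos_left h2 (by positivity)
        have h4 : (s + u₁) * y (k + 1) < (s + u₂) * y (k + 1) :=
          mul_lt_mul_of_pos_right (by linarith) hy'
        linarith
      · refine ⟨fun _ => ?_, fun e => absurd (e1.symm.trans e) hlt⟩
        have h2 := i2 e0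
        nlinarith
  rcases h.alternating N with ⟨e, -⟩ | ⟨e, -⟩
  · exfalso
    have h1 := (key N hN1 le_rfl).1 e
    have hy := h.pos N le_rfl
    have hf := h.final hN1
    rw [e] at hf
    have e1 : s * y N ^ 2 * γ ^ 2 = (1 - u₁ * γ ^ 2 * y N) * (y N - γ ^ 2) := by
      field_simp at hf
      linear_combination hf
    have hp : 0 < s * y N ^ 2 * γ ^ 2 := by positivity
    rw [e1] at hp
    have h2 : u₁ * γ ^ 2 < 1 := by nlinarith
    have h3 : u₁ * γ ^ 2 * y N < 1 := by nlinarith [mul_pos hu₁ (by linarith : 0 < γ ^ 2)]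
    nlinarith
  · exact e

end IsSwitchingSequence

theorem sq_discrim_of_root {A c z : ℝ} (h : A * z ^ 2 - c * z + 1 = 0) :
    (2 * A * z - c) ^ 2 = c ^ 2 - 4 * A := by
  linear_combination 4 * A * h

theorem exists_sign_of_root {A c z : ℝ} (h : A * z ^ 2 - c * z + 1 = 0) :
    ∃ σ : ℝ, (σ = 1 ∨ σ = -1) ∧ 2 * A * z = c + σ * √(c ^ 2 - 4 * A) := by
  rw [← sq_discrim_of_root h, Real.sqrt_sq_eq_abs]
  rcases abs_cases (2 * A * z - c) with ⟨e, -⟩ | ⟨e, -⟩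
  · exact ⟨1, Or.inl rfl, by rw [e]; ring⟩
  · exact ⟨-1, Or.inr rfl, by rw [e]; ring⟩

/-- The roots have product `1 / A`, so `A z² ≥ 1` singles out the larger one. -/
theorem eq_larger_root {A c z : ℝ} (hz : 0 < z) (h : A * z ^ 2 - c * z + 1 = 0)
    (h1 : 1 ≤ A * z ^ 2) : 2 * A * z = c + √(c ^ 2 - 4 * A) := by
  have h2 : 0 ≤ (2 * A * z - c) * z := by linarith
  rw [← sq_discrim_of_root h, Real.sqrt_sq (nonneg_of_mul_nonneg_left h2 hz)]
  ring

end

section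

variable {u₁ u₂ γ T p₀ D : ℝ} {x₁ x₂ u W V : ℝ → ℝ} {α β ε : ℝ} {N : ℕ} {τ : ℕ → ℝ}

/-! ### The durations -/

namespace IsArcChain

theorem control_pos (C : IsArcChain u₁ u₂ T u W α β ε N τ) (hu₁ : 0 < u₁) (hu₂ : 0 < u₂) (k : ℕ) :
    0 < if Even k then α else β := by
  rcases C.pair.sign k with ⟨-, h⟩ | ⟨-, h⟩ <;> rwa [h]

theorem node_mem (C : IsArcChain u₁ u₂ T u W α β ε N τ) {k : ℕ} (hk : k ≤ N) : τ k ∈ Icc 0 T :=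
  ⟨(C.arc k hk).nonneg, ((C.arc k hk).lt.le).trans (C.arc k hk).le⟩

theorem switchingSequence (C : IsArcChain u₁ u₂ T u W α β ε N τ)
    (S : IsSwitchingSystem u₁ u₂ T p₀ D x₁ x₂ u W V) (hu₁ : 0 < u₁) (hu₂ : 0 < u₂)
    (h01 : x₁ 0 = 1) (h02 : x₂ 0 = 0) (hT1 : x₁ T = γ) (hT2 : x₂ T = 0) :
    IsSwitchingSequence u₁ u₂ γ (p₀ ^ 2 / D) N (fun k => if Even k then α else β)
      (fun k => x₁ (τ k) ^ 2) where
  alternating k := by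
    rcases C.pair with ⟨-, rfl, rfl⟩ | ⟨-, rfl, rfl⟩ <;> by_cases hk : Even k <;>
      simp [hk, Nat.even_add_one]
  pos k hk := pow_pos (S.trajectory.pos _ (C.node_mem hk)) 2
  initial hN := by
    have A := C.arc 0 (Nat.zero_le N)
    have h1 := S.state_energy A A.right_mem
    have hm := C.node_mem hN
    have hx := (S.trajectory.pos _ hm).ne'
    rw [zero_add, C.initial, h01, h02, S.sq_state_snd hm (C.switching 1 le_rfl hN)] at h1
    have e : 1 / x₁ (τ 1) ^ 2 * x₁ (τ 1) ^ 2 = 1 := by field_simp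
    linear_combination x₁ (τ 1) ^ 2 * h1 - e
  step k hk hkN := S.state_of_full_arc (C.arc k (by omega)) (C.control_pos hu₁ hu₂ k)
    (C.switching k hk (by omega)) (C.switching (k + 1) (by omega) hkN)
  final hN := by
    have A := C.arc N le_rfl
    have h1 := S.state_energy A A.right_mem
    have hm := C.node_mem (le_refl N)
    have hx := (S.trajectory.pos _ hm).ne'
    rw [C.final, hT1, hT2, S.sq_state_snd hm (C.switching N hN le_rfl)] at h1
    have e : 1 / x₁ (τ N) ^ 2 * x₁ (τ N) ^ 2 = 1 := by field_simp
    linear_combination (-x₁ (τ N) ^ 2) * h1 - e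
  single hN := by
    subst hN
    have A := C.arc 0 le_rfl
    have h1 := S.state_energy A A.right_mem
    rw [C.final, C.initial, h01, h02, hT1, hT2] at h1
    linear_combination -h1

/-- Dividing the product relations of the `Y`-arc and the `X`-arc cancels the intermediate value of
`x₁²`. -/
theorem two_steps (C : IsArcChain u₁ u₂ T u W α β ε N τ)
    (S : IsSwitchingSystem u₁ u₂ T p₀ D x₁ x₂ u W V) (hu₁ : 0 < u₁) (hu₂ : 0 < u₂) {k : ℕ}
    (hk : 1 ≤ k) (hkN : k + 2 ≤ N) (hY : (if Even k then α else β) = u₂)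
    (hX : (if Even (k + 1) then α else β) = u₁) (hne : u₁ ≠ u₂) :
    τ (k + 2) = τ k + (timeX u₁ (p₀ ^ 2 / D) + timeY u₂ (p₀ ^ 2 / D)) ∧
      x₁ (τ (k + 2)) ^ 2 = (p₀ ^ 2 / D + u₂) / (p₀ ^ 2 / D + u₁) * x₁ (τ k) ^ 2 := by
  have A := C.arc k (by omega)
  have B := C.arc (k + 1) (by omega)
  have w0 := C.switching k hk (by omega)
  have w1 := C.switching (k + 1) (by omega) (by omega)
  have w2 := C.switching (k + 1 + 1) (by omega) hkN
  have hA : (-1) ^ k * ε = -1 := by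
    rcases C.pair.sign k with ⟨-, h⟩ | ⟨h, -⟩
    · exact absurd (h.symm.trans hY) hne
    · exact h
  have hB : (-1) ^ (k + 1) * ε = 1 := by rw [pow_succ]; linarith
  rw [hY, hA] at A
  rw [hX, hB] at B
  have hD := S.energy_pos (A.subset A.left_mem) w0
  have h1 := S.duration_of_full_arc_neg A hu₂ w0 w1
  have h2 := S.duration_of_full_arc_pos B hu₁ w1 w2
  have h3 := S.state_of_full_arc A hu₂ w0 w1
  have h4 := S.state_of_full_arc B hu₁ w1 w2
  have hx := (S.trajectory.pos _ (B.subset B.left_mem)).ne'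
  refine ⟨by rw [show k + 2 = k + 1 + 1 from rfl]; linarith, ?_⟩
  have hs : 0 < p₀ ^ 2 / D + u₁ := by positivity
  rw [show k + 2 = k + 1 + 1 from rfl, div_mul_eq_mul_div, eq_div_iff hs.ne']
  refine mul_right_cancel₀ (pow_ne_zero 2 hx) ?_
  linear_combination h4 - h3

theorem iterate_two_steps (C : IsArcChain u₁ u₂ T u W α β ε N τ)
    (S : IsSwitchingSystem u₁ u₂ T p₀ D x₁ x₂ u W V) (hu₁ : 0 < u₁) (hu₂ : 0 < u₂) {k : ℕ}
    (hk : 1 ≤ k) (hY : (if Even k then α else β) = u₂)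
    (hX : (if Even (k + 1) then α else β) = u₁) (hne : u₁ ≠ u₂) (j : ℕ) (hj : k + 2 * j ≤ N) :
    τ (k + 2 * j) = τ k + j * (timeX u₁ (p₀ ^ 2 / D) + timeY u₂ (p₀ ^ 2 / D)) ∧
      x₁ (τ (k + 2 * j)) ^ 2 =
        ((p₀ ^ 2 / D + u₂) / (p₀ ^ 2 / D + u₁)) ^ j * x₁ (τ k) ^ 2 := by
  induction j with
  | zero => simp
  | succ j ih =>
    obtain ⟨i1, i2⟩ := ih (by omega)
    have e : Even (k + 2 * j) ↔ Even k := by simp [Nat.even_add]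
    have e' : Even (k + 2 * j + 1) ↔ Even (k + 1) := by simp [Nat.even_add_one, e]
    obtain ⟨h1, h2⟩ := C.two_steps S hu₁ hu₂ (k := k + 2 * j) (by omega) (by omega)
      (by simpa only [e] using hY) (by simpa only [e'] using hX) hne
    rw [show k + 2 * (j + 1) = k + 2 * j + 2 by ring]
    exact ⟨by rw [h1, i1]; push_cast; ring, by rw [h2, i2]; ring⟩

end IsArcChain

/-! ### Closed forms for the first and last arcs -/

theorem initX_argument {u₁ s z R : ℝ} (σ : ℝ) (hs : 0 < s) (hu₁ : 0 < u₁) (h1 : u₁ < 1)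
    (hz : 2 * (s + u₁) * z = u₁ + 1 + σ * R) :
    (2 * u₁ * z - (u₁ + 1)) / (u₁ - 1) =
      (s * (u₁ + 1) - σ * u₁ * R) / ((s + u₁) * √((u₁ + 1) ^ 2 - 4 * u₁)) := by
  have e : √((u₁ + 1) ^ 2 - 4 * u₁) = 1 - u₁ := by
    rw [show (u₁ + 1) ^ 2 - 4 * u₁ = (1 - u₁) ^ 2 by ring, Real.sqrt_sq (by linarith)]
  have h2 : 1 - u₁ ≠ 0 := by linarith
  have h3 : u₁ - 1 ≠ 0 := by linarith
  have h4 : s + u₁ ≠ 0 := by positivity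
  rw [e, div_eq_div_iff h3 (mul_ne_zero h4 h2)]
  linear_combination (1 - u₁) * u₁ * hz

theorem initY_argument {u₂ s z R : ℝ} (σ : ℝ) (hs : 0 < s) (h1 : 1 < u₂)
    (hz : 2 * (s + u₂) * z = u₂ + 1 + σ * R) :
    (2 * u₂ * z - (u₂ + 1)) / (u₂ - 1) =
      (-s * (u₂ + 1) + σ * u₂ * R) / ((s + u₂) * √((u₂ + 1) ^ 2 - 4 * u₂)) := by
  have e : √((u₂ + 1) ^ 2 - 4 * u₂) = u₂ - 1 := by
    rw [show (u₂ + 1) ^ 2 - 4 * u₂ = (u₂ - 1) ^ 2 by ring, Real.sqrt_sq (by linarith)]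
  have h3 : u₂ - 1 ≠ 0 := by linarith
  have h4 : s + u₂ ≠ 0 := by positivity
  rw [e, div_eq_div_iff h3 (mul_ne_zero h4 h3)]
  linear_combination (u₂ - 1) * u₂ * hz

theorem cFin_sq_sub {u₂ γ : ℝ} (hγ : γ ≠ 0) :
    cFin u₂ γ ^ 2 - 4 * u₂ = (u₂ * γ ^ 2 - 1 / γ ^ 2) ^ 2 := by
  rw [cFin]; field_simp; ring

theorem add_one_lt_cFin {u₂ γ : ℝ} (hγ : 1 < γ) (hu₂ : 1 ≤ u₂) : u₂ + 1 < cFin u₂ γ := by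
  have hg : 1 < γ ^ 2 := one_lt_pow₀ hγ two_ne_zero
  have h1 : cFin u₂ γ - (u₂ + 1) = (γ ^ 2 - 1) * (u₂ * γ ^ 2 - 1) / γ ^ 2 := by
    rw [cFin]; field_simp; ring
  have h2 : 0 < (γ ^ 2 - 1) * (u₂ * γ ^ 2 - 1) / γ ^ 2 :=
    div_pos (mul_pos (by linarith) (by nlinarith)) (by positivity)
  linarith

/-- Eliminating the constant terms gives `(z - y) (A y z - 1) = (c' - c) y z > 0`, so `z > y`. It
selects the larger root at the last switching of the form `YXY…XY`, where first and last arc share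
the control. -/
theorem one_le_mul_sq_of_lt {A c c' y z : ℝ} (hA : 0 < A) (hy : 0 < y) (hz : 0 < z)
    (h1 : A * y ^ 2 - c * y + 1 = 0) (h2 : A * z ^ 2 - c' * z + 1 = 0) (hc : c < c')
    (hyz : 1 < A * (y * z)) : 1 ≤ A * z ^ 2 := by
  have hp : 0 < (z - y) * (A * (y * z) - 1) := by
    rw [show (z - y) * (A * (y * z) - 1) = (c' - c) * (y * z) by
      linear_combination y * h2 - z * h1]
    exact mul_pos (sub_pos.mpr hc) (mul_pos hy hz)
  have hzy : y < z := sub_pos.mp (pos_of_mul_pos_left hp (sub_pos.mpr hyz).le)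
  have h3 : y * z ≤ z ^ 2 := by rw [sq]; exact mul_le_mul_of_nonneg_right hzy.le hz.le
  exact hyz.le.trans (mul_le_mul_of_nonneg_left h3 hA.le)

theorem fin_argument {u₂ γ s z R : ℝ} (hs : 0 < s) (hu₂ : 0 < u₂) (hγ : γ ≠ 0)
    (h1 : 0 < u₂ * γ ^ 2 - 1 / γ ^ 2) (hz : 2 * (s + u₂) * z = cFin u₂ γ + R) :
    (2 * u₂ * z - cFin u₂ γ) / (u₂ * γ ^ 2 - 1 / γ ^ 2) =
      (-s * cFin u₂ γ + u₂ * R) / ((s + u₂) * √(cFin u₂ γ ^ 2 - 4 * u₂)) := by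
  have h4 : s + u₂ ≠ 0 := by positivity
  rw [cFin_sq_sub hγ, Real.sqrt_sq h1.le, div_eq_div_iff h1.ne' (mul_ne_zero h4 h1.ne')]
  linear_combination (u₂ * γ ^ 2 - 1 / γ ^ 2) * u₂ * hz

/-- Used at the two endpoints of a normal extremal, which are turning points and hence not
switchings. -/
theorem IsSwitchingSystem.switching_ne_zero (S : IsSwitchingSystem u₁ u₂ T p₀ D x₁ x₂ u W V)
    (hp₀ : p₀ ≠ 0) {t : ℝ} (ht : t ∈ Icc 0 T) (h : x₂ t = 0) : W t ≠ 0 := by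
  intro hW
  have h1 := S.velocity_mul ht hW
  rw [h, mul_zero] at h1
  exact mul_ne_zero hp₀ (S.trajectory.pos t ht).ne' h1.symm

/-- An extremal with its switching system, in the normal case. -/
structure IsNormal (u₁ u₂ γ T p₀ D : ℝ) (x₁ x₂ u W V : ℝ → ℝ) : Prop extends
    IsSwitchingSystem u₁ u₂ T p₀ D x₁ x₂ u W V where
  neg : p₀ < 0
  initial₁ : x₁ 0 = 1
  initial₂ : x₂ 0 = 0
  final₁ : x₁ T = γ
  final₂ : x₂ T = 0

/-! ### Total durations of normal extremals -/

namespace IsNormal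

theorem duration_odd (S : IsNormal u₁ u₂ γ T p₀ D x₁ x₂ u W V) (hγ : 1 < γ) (hu₁ : 0 < u₁)
    (hu₁1 : u₁ < 1) (hu₂ : 1 ≤ u₂) {n : ℕ} (h : IsFormXY u₁ u₂ T u n) :
    ∃ σ s : ℝ, (σ = 1 ∨ σ = -1) ∧ SolvesOdd u₁ u₂ γ σ n s ∧ T = timeOdd u₁ u₂ γ σ n s := by
  have hne : u₁ ≠ u₂ := by linarith
  have hu₂0 : 0 < u₂ := by linarith
  have hγ0 : γ ≠ 0 := by linarith
  have SS := S.toIsSwitchingSystem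
  obtain ⟨τ, C⟩ := SS.exists_arcChain hne (Or.inl ⟨rfl, rfl, rfl⟩) h
  have Q := C.switchingSequence SS hu₁ hu₂0 S.initial₁ S.initial₂ S.final₁ S.final₂
  obtain ⟨i1, i2⟩ := C.iterate_two_steps SS hu₁ hu₂0 (k := 1) le_rfl (by simp) (by simp) hne n
    (by omega)
  have hw1 := C.switching 1 le_rfl (by omega)
  have hD := SS.energy_pos (C.node_mem (k := 1) (by omega)) hw1
  have hp₀ := S.neg
  have hs : 0 < p₀ ^ 2 / D := div_pos (even_two.pow_pos hp₀.ne) hD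
  have hg : 1 < γ ^ 2 := by nlinarith
  have hK : 0 < u₂ * γ ^ 2 - 1 / γ ^ 2 := by
    have : 1 / γ ^ 2 < 1 := (div_lt_one (by positivity)).mpr hg
    nlinarith
  have hwN := C.switching (1 + 2 * n) (by omega) (by omega)
  have A0 := C.arc 0 (by omega)
  have AN := C.arc (2 * n + 1) le_rfl
  have q1 := Q.initial (by omega)
  have qN := Q.final (by omega)
  have hy1 := (Q.first_of_pos hs (by omega) hu₁1 hu₂ hu₁).1 (by simp)
  have hyN0 := Q.pos (2 * n + 1) le_rfl
  have hodd : (if Even (2 * n + 1) then u₁ else u₂) = u₂ := by simp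
  rw [C.final, hodd, show (-1 : ℝ) ^ (2 * n + 1) * 1 = -1 by simp [pow_succ]] at AN
  simp only [pow_zero, one_mul, zero_add, C.initial, Even.zero, if_true] at A0
  simp only [Even.zero, if_true] at q1
  simp only [hodd] at qN
  rw [← cFin] at qN
  have d0 := SS.initial_arc A0 hu₁ hp₀ (by linarith) S.initial₁ S.initial₂
    (SS.switching_ne_zero hp₀.ne ⟨le_rfl, SS.time_pos.le⟩ S.initial₂) hw1
  rw [add_comm 1 (2 * n)] at i1 i2 hwN
  have dN := SS.final_arc AN hu₂0 hp₀ hK S.final₁ S.final₂ hwN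
    (SS.switching_ne_zero hp₀.ne ⟨SS.time_pos.le, le_rfl⟩ S.final₂)
  generalize p₀ ^ 2 / D = s at *
  generalize x₁ (τ 1) ^ 2 = y at *
  generalize x₁ (τ (2 * n + 1)) ^ 2 = z at *
  have hr : 1 ≤ (s + u₂) / (s + u₁) := (one_le_div (by positivity)).mpr (by linarith)
  have hz1 : 1 < z := by
    rw [i2]
    nlinarith [one_le_pow₀ hr (n := n)]
  obtain ⟨σ, hσ, e1⟩ := exists_sign_of_root q1
  have eN := eq_larger_root hyN0 qN (by nlinarith)
  have r1 := sq_discrim_of_root q1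
  have rN := sq_discrim_of_root qN
  -- The upper bounds on `s` say that the discriminants of the first and last quadratics are
  -- nonnegative.
  refine ⟨σ, s, hσ, ⟨⟨hs, le_min ?_ ?_⟩, ?_⟩, ?_⟩
  · have h1 := r1 ▸ sq_nonneg (2 * (s + u₁) * y - (u₁ + 1))
    linarith
  · rw [← cFin_sq_sub hγ0]
    have h1 := rN ▸ sq_nonneg (2 * (s + u₂) * z - cFin u₂ γ)
    linarith
  · rw [← e1, ← eN, i2]
    have h1 : y ≠ 0 := by linarith
    have h2 : s + u₁ ≠ 0 := by positivity
    rw [pow_succ]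
    generalize ((s + u₂) / (s + u₁)) ^ n = P
    field_simp
  · rw [initX_argument σ hs hu₁ hu₁1 e1] at d0
    rw [fin_argument hs hu₂0 hγ0 hK eN] at dN
    rw [timeOdd, timeInitX, timeFin, ← d0, ← dN, i1]
    ring

theorem duration_even (S : IsNormal u₁ u₂ γ T p₀ D x₁ x₂ u W V) (hγ : 1 < γ) (hu₁ : 0 < u₁)
    (hu₁1 : u₁ < 1) (hu₂ : 1 ≤ u₂) {n : ℕ} (hn : 1 ≤ n) (h : IsFormYXY u₁ u₂ T u n) :
    ∃ σ s : ℝ, (σ = 1 ∨ σ = -1) ∧ SolvesEven u₁ u₂ γ σ n s ∧ T = timeEven u₁ u₂ γ σ n s := by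
  -- After the initial `Y` and `X` there remain `m = n - 1` pairs `YX` before the final `Y`.
  obtain ⟨m, rfl⟩ : ∃ m, n = m + 1 := ⟨n - 1, by omega⟩
  have hne : u₁ ≠ u₂ := by linarith
  have hu₂0 : 0 < u₂ := by linarith
  have hγ0 : γ ≠ 0 := by linarith
  have SS := S.toIsSwitchingSystem
  obtain ⟨τ, C⟩ := SS.exists_arcChain hne (Or.inr ⟨rfl, rfl, rfl⟩) h
  have Q := C.switchingSequence SS hu₁ hu₂0 S.initial₁ S.initial₂ S.final₁ S.final₂
  obtain ⟨i1, i2⟩ := C.iterate_two_steps SS hu₁ hu₂0 (k := 2) (by norm_num) (by simp)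
    (by simp [Nat.even_add_one]) hne m (by omega)
  have hw1 := C.switching 1 le_rfl (by omega)
  have hw2 := C.switching 2 (by norm_num) (by omega)
  have hD := SS.energy_pos (C.node_mem (k := 1) (by omega)) hw1
  have hp₀ := S.neg
  have hs : 0 < p₀ ^ 2 / D := div_pos (even_two.pow_pos hp₀.ne) hD
  have hg : 1 < γ ^ 2 := by nlinarith
  have hK : 0 < u₂ * γ ^ 2 - 1 / γ ^ 2 := by
    have : 1 / γ ^ 2 < 1 := (div_lt_one (by positivity)).mpr hg
    nlinarith
  have hwN := C.switching (2 * (m + 1)) (by omega) le_rfl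
  have A0 := C.arc 0 (by omega)
  have A1 := C.arc 1 (by omega)
  have AN := C.arc (2 * (m + 1)) le_rfl
  have q1 := Q.initial (by omega)
  have q2 := Q.step 1 le_rfl (by omega)
  have qN := Q.final (by omega)
  have hy0 := Q.pos 1 (by omega)
  have hz0 := Q.pos (2 * (m + 1)) le_rfl
  have heven : (if Even (2 * (m + 1)) then u₂ else u₁) = u₂ := by simp
  have hone : (if Even 1 then u₂ else u₁) = u₁ := by simp
  rw [C.final, heven, show (-1 : ℝ) ^ (2 * (m + 1)) * -1 = -1 by simp [pow_mul]] at AN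
  rw [hone, show (-1 : ℝ) ^ 1 * -1 = 1 by norm_num] at A1
  simp only [pow_zero, one_mul, zero_add, C.initial, Even.zero, if_true] at A0
  simp only [Even.zero, if_true] at q1
  simp only [heven] at qN
  simp only [hone] at q2
  rw [← cFin] at qN
  have hW0 := SS.switching_ne_zero hp₀.ne ⟨le_rfl, SS.time_pos.le⟩ S.initial₂
  -- If `u₂ = 1`, then `(1, 0)` is an equilibrium of the `Y`-system, and `H = 0` at time `0` would
  -- give `p₀ = 0`.
  have hu₂1 : 1 < u₂ := by
    have h1 := SS.hamiltonian 0 ⟨le_rfl, SS.time_pos.le⟩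
    have h2 := SS.sign_switching A0 A0.left_mem
    rw [SS.feedback_eq A0 A0.left_mem, S.initial₁, S.initial₂] at h1
    refine lt_of_le_of_ne hu₂ fun e => ?_
    rw [← e] at h1
    norm_num at h1
    linarith
  have d0 := SS.initial_arc A0 hu₂0 hp₀ (by linarith) S.initial₁ S.initial₂ hW0 hw1
  have d1 := SS.duration_of_full_arc_pos A1 hu₁ hw1 hw2
  rw [show 2 + 2 * m = 2 * (m + 1) by ring] at i1 i2
  have dN := SS.final_arc AN hu₂0 hp₀ hK S.final₁ S.final₂ hwN
    (SS.switching_ne_zero hp₀.ne ⟨SS.time_pos.le, le_rfl⟩ S.final₂)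
  norm_num only at q2 d1
  generalize p₀ ^ 2 / D = s at *
  generalize x₁ (τ 1) ^ 2 = y at *
  generalize x₁ (τ (2 * (m + 1))) ^ 2 = z at *
  have hsu : 0 < s + u₁ := by positivity
  have hr : 1 ≤ (s + u₂) / (s + u₁) := (one_le_div hsu).mpr (by linarith)
  have hyz : (s + u₁) * y * z = ((s + u₂) / (s + u₁)) ^ m := by
    rw [i2]
    linear_combination ((s + u₂) / (s + u₁)) ^ m * q2
  have hyz1 : 1 < (s + u₂) * (y * z) := by
    have h1 : 1 ≤ (s + u₁) * y * z := hyz ▸ one_le_pow₀ hr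
    have h2 : 0 < y * z := mul_pos hy0 hz0
    nlinarith
  have hlarge := one_le_mul_sq_of_lt (by positivity) hy0 hz0 q1 qN (add_one_lt_cFin hγ hu₂) hyz1
  obtain ⟨σ, hσ, e1⟩ := exists_sign_of_root q1
  have eN := eq_larger_root hz0 qN hlarge
  have r1 := sq_discrim_of_root q1
  refine ⟨σ, s, hσ, ⟨⟨hs, ?_⟩, ?_⟩, ?_⟩
  · have h1 := r1 ▸ sq_nonneg (2 * (s + u₂) * y - (u₂ + 1))
    linarith
  -- The denominator carries the root conjugate to `y`, since here the product `y z` is known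
  -- instead of the quotient; hence the opposite sign in the equation.
  · have hden : (u₂ + 1 - σ * √((u₂ + 1) ^ 2 - 4 * (s + u₂))) * y = 2 := by
      linear_combination (-2) * q1 + y * e1
    have hden0 : u₂ + 1 - σ * √((u₂ + 1) ^ 2 - 4 * (s + u₂)) ≠ 0 := by
      intro h0
      rw [h0] at hden
      norm_num at hden
    rw [← eN, div_eq_iff hden0, pow_succ, ← hyz]
    have e2 : (s + u₂) / (s + u₁) * (s + u₁) = s + u₂ := by field_simp
    linear_combination (-(s + u₂) * z) * hden - y * z *
      (u₂ + 1 - σ * √((u₂ + 1) ^ 2 - 4 * (s + u₂))) * e2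
  · rw [initY_argument σ hs hu₂1 e1] at d0
    rw [fin_argument hs hu₂0 hγ0 hK eN] at dN
    rw [timeEven, timeInitY, timeFin, ← d0, ← dN, i1]
    push_cast
    linarith

end IsNormal

theorem IsExtremal.exists_normal (hγ : 1 < γ) (hu₁ : 0 < u₁) (hu₁γ : u₁ ≤ 1 / γ ^ 4)
    (hu₂ : 1 ≤ u₂) (h : IsExtremal u₁ u₂ γ T x₁ x₂ u) :
    ∃ (p₀ D : ℝ) (W V : ℝ → ℝ), IsNormal u₁ u₂ γ T p₀ D x₁ x₂ u W V := by
  have hu₁1 := lt_one_of_le_inv_pow hγ hu₁γ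
  obtain ⟨p₀, D, W, V, S⟩ := h.exists_switchingSystem hu₁ (by linarith) hγ.ne'
  refine ⟨p₀, D, W, V, S, lt_of_le_of_ne S.nonpos ?_, h.initial₁, h.initial₂, h.final₁, h.final₂⟩
  rintro rfl
  -- An abnormal extremal is also bang-bang, and its switching sequence has `s = 0`, which was
  -- excluded.
  obtain ⟨α, β, ε, N, hpair, hB⟩ := S.exists_isBangBang
  obtain ⟨τ, C⟩ := S.exists_arcChain (by linarith) hpair hB
  exact (C.switchingSequence S hu₁ (by linarith) h.initial₁ h.initial₂ h.final₁
    h.final₂).invariant_ne_zero hγ hu₁ hu₁γ hu₂ (by simp)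

theorem IsNormal.form (S : IsNormal u₁ u₂ γ T p₀ D x₁ x₂ u W V) (hγ : 1 < γ) (hu₁ : 0 < u₁)
    (hu₁γ : u₁ ≤ 1 / γ ^ 4) (hu₂ : 1 ≤ u₂) :
    (∃ n : ℕ, IsFormXY u₁ u₂ T u n) ∨ (∃ n : ℕ, 1 ≤ n ∧ IsFormYXY u₁ u₂ T u n) := by
  have hu₁1 := lt_one_of_le_inv_pow hγ hu₁γ
  have hne : u₁ ≠ u₂ := by linarith
  have SS := S.toIsSwitchingSystem
  obtain ⟨α, β, ε, N, hpair, hB⟩ := SS.exists_isBangBang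
  obtain ⟨τ, C⟩ := SS.exists_arcChain hne hpair hB
  have Q := C.switchingSequence SS hu₁ (by linarith) S.initial₁ S.initial₂ S.final₁ S.final₂
  have hN := Q.ne_zero hγ hu₁γ hu₂
  -- The existence of a switching gives `D > 0`, so `s > 0`; the last control is then `u₂`, and the
  -- first control fixes the parity of `N`.
  have hD := SS.energy_pos (C.node_mem (k := 1) (by omega)) (C.switching 1 le_rfl (by omega))
  have hlast := Q.last_control (div_pos (even_two.pow_pos S.neg.ne) hD) hγ hu₁ hu₁γ hu₂
  rcases hpair with ⟨-, rfl, rfl⟩ | ⟨-, rfl, rfl⟩ <;> rcases Nat.even_or_odd' N with ⟨n, rfl | rfl⟩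
  · simp [hne] at hlast
  · exact Or.inl ⟨n, hB⟩
  · exact Or.inr ⟨n, by omega, hB⟩
  · simp [hne] at hlast

end

end Ermakov

/-- Every extremal of the minimum-time transfer from `(1, 0)` to `(γ, 0)` is bang-bang, of the
form `XYX…XY` with `2 n + 1` switchings or of the form `YXY…XY` with `2 n` switchings, `n ≥ 1`,
and its duration is given by the explicit formulas. -/
theorem mainTheorem1 (u₁ u₂ γ : ℝ) (hγ : 1 < γ) (hu₁ : 0 < u₁) (hu₁γ : u₁ ≤ 1 / γ ^ 4)
    (hu₂ : 1 ≤ u₂) (T : ℝ) (x₁ x₂ u : ℝ → ℝ)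
    (hext : Ermakov.IsExtremal u₁ u₂ γ T x₁ x₂ u) :
    ((∃ n : ℕ, Ermakov.IsFormXY u₁ u₂ T u n) ∨
      (∃ n : ℕ, 1 ≤ n ∧ Ermakov.IsFormYXY u₁ u₂ T u n)) ∧
    (∀ n : ℕ, Ermakov.IsFormXY u₁ u₂ T u n →
      ∃ σ s : ℝ, (σ = 1 ∨ σ = -1) ∧ Ermakov.SolvesOdd u₁ u₂ γ σ n s ∧
        T = Ermakov.timeOdd u₁ u₂ γ σ n s) ∧
    (∀ n : ℕ, 1 ≤ n → Ermakov.IsFormYXY u₁ u₂ T u n →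
      ∃ σ s : ℝ, (σ = 1 ∨ σ = -1) ∧ Ermakov.SolvesEven u₁ u₂ γ σ n s ∧
        T = Ermakov.timeEven u₁ u₂ γ σ n s) := by
  obtain ⟨p₀, D, W, V, S⟩ := hext.exists_normal hγ hu₁ hu₁γ hu₂
  have hu₁1 := Ermakov.lt_one_of_le_inv_pow hγ hu₁γ
  exact ⟨S.form hγ hu₁ hu₁γ hu₂, fun n h => S.duration_odd hγ hu₁ hu₁1 hu₂ h,
    fun n hn h => S.duration_even hγ hu₁ hu₁1 hu₂ hn h⟩
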